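/- Let $q\in(0,1)$, $\theta=\min(q,1-q)$, $h\in(0,1]$, $T\ge 1$, and let $\mu$ be a probability measure on the action space $\mathcal A$. The expectile loss of a prediction $w$ for an outcome $v$ is $g(v,w)=(1-q)((v-w)_+)^2+q((w-v)_+)^2$, and for a distribution $D$ on $[0,1]$ let $\mathrm{EVaR}_q(D)=\arg\min_{w\in[0,1]}\mathbb E_{v\sim D}[g(v,w)]$. *Protocol.* In each round $t=1,\dots,T$ an environment, which may be adaptive to the history (the previous contexts, loss functions and actions), chooses a context $x_t$ and a conditional distribution $\mathbb P_{l_t}(\cdot\mid x_t)$ of a loss function $l_t:\mathcal A\to[0,1]$. The learner sees $x_t$, plays $a_t$ and observes $l_t(a_t)$; given the history and $x_t$, the function $l_t$ and the action $a_t$ are independent. Write $\rho_t(a)$ for $\mathrm{EVaR}_q$ of the conditional distribution of $l_t(a)$. Let $\mathcal F$ be a class of functions $\mathcal X\times\mathcal A\to[0,1]$, and assume realizability: there is one $f^*\in\mathcal F$ with $f^*(x_t,a)=\rho_t(a)$ for all $t$ and $a$, whatever the history and the context. *Oracles.* The online regression oracle produces in round $t$, from the observations $(x_s,a_s,l_s(a_s))_{s<t}$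 and $x_t$, a function $\hat f_t$ in a class $\mathcal G$ of functions $\mathcal X\times\mathcal A\to[0,1]$ (for instance $\mathcal G=\mathcal F$), and on every sequence of contexts $x_t$, actions $a_t$ and outcomes $v_t\in[0,1]$ it satisfies $\sum_{t=1}^T\big(g(v_t,\hat f_t(x_t,a_t))-g(v_t,f(x_t,a_t))\big)\le R$ for all $f\in\mathcal F$, where $R=\mathrm{Reg}_{\mathrm{EVaR}_q}(T)$ does not depend on the sequence. For every $\delta>0$, $f\in\mathcal G$ and context $x$, the randomized optimization oracle outputs an action $\hat a$ with $\mathbb E_{\hat a}\,\mathbb E_{a\sim\mu}[\max(0,f(x,\hat a)-f(x,a))]\le\delta$. *Algorithm with parameter $\gamma>0$.* In round $t$ obtain $\hat f_t$ from the regression oracle, obtain $\hat a_t$ from the optimization oracle for $\hat f_t(x_t,\cdot)$ with accuracy $\delta=\frac1{4\theta\gamma}$, and sample $a_t$ from $(1-\tilde M(\mathcal A))\,\mathbf 1_{\hat a_t}+\tilde M$, where $\frac{d\tilde M}{d\mu}(a)=\frac1{1+4\theta\gamma h\max(0,\hat f_t(x_t,a)-\hat f_t(x_t,\hat a_t))}$.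 *Regret.* Let $P_t$ be the distribution of $a_t$ given the history and $x_t$, and $$\mathrm{Reg}_{CB}^{(h,\mu)}(T)=\sum_{t=1}^T\Big(\mathbb E_{a\sim P_t}[\rho_t(a)]-\inf_{Q:\ dQ/d\mu\le 1/h}\mathbb E_{a\sim Q}[\rho_t(a)]\Big),$$ where $Q$ ranges over probability measures absolutely continuous with respect to $\mu$. **Theorem.** The expectation over the interaction satisfies $$\mathbb E\,\mathrm{Reg}_{CB}^{(h,\mu)}(T)=O\Big(\tfrac1\theta\sqrt{\tfrac1h\,T\,R}\Big)$$ with a universal constant. Precisely, $\mathrm{Reg}_{CB}^{(h,\mu)}(T)$ is integrable for both choices of $\gamma$ below, and: 1. with $\gamma=\sqrt{\dfrac{3T}{h\,(16+12\theta(1+R))}}$ one has $\mathbb E\,\mathrm{Reg}_{CB}^{(h,\mu)}(T)\le\dfrac1\theta\sqrt{\dfrac{3T}{h}\,\big(4+3\theta(1+R)\big)}$; 2. if $R>0$, then with $\gamma=\sqrt{\dfrac{3T}{4\theta hR}}$ one has $\mathbb E\,\mathrm{Reg}_{CB}^{(h,\mu)}(T)\le\sqrt3\cdot\dfrac1\theta\sqrt{\dfrac1h\,T\,R}$.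 -/

import Mathlib

open MeasureTheory ProbabilityTheory Set

noncomputable section

namespace RiskCB

/-! ### Expectiles -/

/-- The expectile loss `(1 - q) ((v - w)₊)² + q ((w - v)₊)²` of the prediction `w` for the
outcome `v`. -/
def expectileLoss (q v w : ℝ) : ℝ :=
  (1 - q) * max (v - w) 0 ^ 2 + q * max (w - v) 0 ^ 2

/-- `w` minimizes the expected expectile loss over `[0, 1]`. -/
def IsExpectile (q : ℝ) (D : Measure ℝ) (w : ℝ) : Prop :=
  w ∈ Icc (0 : ℝ) 1 ∧ IsMinOn (fun w' => ∫ v, expectileLoss q v w' ∂D) (Icc 0 1) w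

/-- The risk measure `EVaR_q(D) = argmin_{w ∈ [0,1]} E_{v ∼ D} [expectileLoss q v w]` of a
distribution `D` of losses.  For `0 < q < 1` and a probability measure `D` on `[0, 1]` the
minimizer exists and is unique. -/
def EVaR (q : ℝ) (D : Measure ℝ) : ℝ :=
  Classical.epsilon (IsExpectile q D)

/-! ### The protocol -/

/-- The history of the first `t` rounds: contexts, (names of) loss functions, actions. -/
abbrev History (X A S : Type*) (t : ℕ) : Type _ := Fin t → X × S × A

/-- An adaptive environment.  A point `s : S` names the loss function `loss s : A → [0, 1]`.
In round `t` (counted from `0`) the context is drawn from `context t` given the history, and then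
the loss function from `lossLaw t` given the history and the context. -/
structure Environment (X A S : Type*) [MeasurableSpace X] [MeasurableSpace A]
    [MeasurableSpace S] where
  loss : S → A → ℝ
  measurable_loss : Measurable fun p : S × A => loss p.1 p.2
  loss_mem : ∀ s a, loss s a ∈ Icc (0 : ℝ) 1
  context : ∀ t : ℕ, Kernel (History X A S t) X
  context_markov : ∀ t, IsMarkovKernel (context t)
  lossLaw : ∀ t : ℕ, Kernel (History X A S t × X) S
  lossLaw_markov : ∀ t, IsMarkovKernel (lossLaw t)

/-- A class of regression functions `X × A → [0, 1]`, named by the points of `Φ`. -/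
structure FunctionClass (Φ X A : Type*) [MeasurableSpace Φ] [MeasurableSpace X]
    [MeasurableSpace A] where
  eval : Φ → X → A → ℝ
  measurable_eval : Measurable fun p : (Φ × X) × A => eval p.1.1 p.1.2 p.2
  eval_mem : ∀ φ x a, eval φ x a ∈ Icc (0 : ℝ) 1

/-- An online regression oracle: in round `t` it sees the earlier contexts, actions and realized
losses of these actions, and the current context, and outputs a regression function. -/
structure RegressionOracle (Φ X A : Type*) [MeasurableSpace Φ] [MeasurableSpace X]
    [MeasurableSpace A] where
  predict : ∀ t : ℕ, (Fin t → X × A × ℝ) → X → Φ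
  measurable_predict : ∀ t, Measurable fun p : (Fin t → X × A × ℝ) × X => predict t p.1 p.2

/-- A randomized optimization oracle for the fixed reference measure: given an accuracy, a
regression function and a context, a distribution over actions. -/
structure OptimizationOracle (Φ X A : Type*) [MeasurableSpace Φ] [MeasurableSpace X]
    [MeasurableSpace A] where
  choose : ℝ → Kernel (Φ × X) A
  choose_markov : ∀ δ, IsMarkovKernel (choose δ)

attribute [instance] Environment.context_markov Environment.lossLaw_markov
  OptimizationOracle.choose_markov

section Setting

variable {X A S Φ : Type*} [MeasurableSpace X] [MeasurableSpace A] [MeasurableSpace S]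
  [MeasurableSpace Φ]

/-- The regression oracle has regret at most `R` after `T` rounds under the expectile loss, on
every sequence of contexts, actions and losses in `[0, 1]`, against every function of the
benchmark class `𝓕`. -/
def RegressionOracle.HasRegretBound (O : RegressionOracle Φ X A) (F : FunctionClass Φ X A)
    (𝓕 : Set Φ) (q : ℝ) (T : ℕ) (R : ℝ) : Prop :=
  ∀ z : Fin T → X × A × ℝ, (∀ t, (z t).2.2 ∈ Icc (0 : ℝ) 1) → ∀ φ ∈ 𝓕,
    ∑ t : Fin T,
      (expectileLoss q (z t).2.2
          (F.eval (O.predict t (fun i => z (Fin.castLE t.isLt.le i)) (z t).1) (z t).1 (z t).2.1)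
        - expectileLoss q (z t).2.2 (F.eval φ (z t).1 (z t).2.1)) ≤ R

/-- The optimization oracle finds minimizers up to the error `δ` relative to `μ`, in expectation
over its own randomness. -/
def OptimizationOracle.IsAccurate (P : OptimizationOracle Φ X A) (F : FunctionClass Φ X A)
    (μ : Measure A) : Prop :=
  ∀ δ : ℝ, 0 < δ → ∀ (φ : Φ) (x : X),
    ∫ b, (∫ a, max 0 (F.eval φ x b - F.eval φ x a) ∂μ) ∂(P.choose δ (φ, x)) ≤ δ

/-- The conditional distribution of the loss of the action `a` in round `t`. -/
def Environment.lossDist (E : Environment X A S) (t : ℕ) (H : History X A S t) (x : X) (a : A) :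
    Measure ℝ :=
  (E.lossLaw t (H, x)).map fun s => E.loss s a

/-- Realizability during the first `T` rounds: one function of `𝓕` gives, in every round, for
every history, context and action, the `EVaR` of the conditional loss distribution. -/
def Environment.Realizable (E : Environment X A S) (F : FunctionClass Φ X A) (𝓕 : Set Φ)
    (q : ℝ) (T : ℕ) : Prop :=
  ∃ φ ∈ 𝓕, ∀ t < T, ∀ (H : History X A S t) (x : X) (a : A),
    F.eval φ x a = EVaR q (E.lossDist t H x a)

/-! ### The algorithm -/

/-- The parameter `θ = min (q, 1 - q)`. -/
def theta (q : ℝ) : ℝ := min q (1 - q)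

/-- The sub-probability measure with density
`1 / (1 + 4 θ γ h max (0, f a - f b))` with respect to `μ`. -/
def exploration (q h γ : ℝ) (μ : Measure A) (f : A → ℝ) (b : A) : Measure A :=
  μ.withDensity fun a =>
    ENNReal.ofReal (1 / (1 + 4 * theta q * γ * h * max 0 (f a - f b)))

/-- The smoothing distribution: the exploration measure, with the missing mass put on the
approximate minimizer `b`. -/
def contAL (q h γ : ℝ) (μ : Measure A) (f : A → ℝ) (b : A) : Measure A :=
  (1 - exploration q h γ μ f b univ) • Measure.dirac b + exploration q h γ μ f b

lemma measurable_contAL (q h γ : ℝ) (μ : Measure A) [SFinite μ] (F : FunctionClass Φ X A) :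
    Measurable fun p : (Φ × X) × A => contAL q h γ μ (F.eval p.1.1 p.1.2) p.2 := by
  have hd : Measurable fun p : ((Φ × X) × A) × A =>
      ENNReal.ofReal (1 / (1 + 4 * theta q * γ * h *
        max 0 (F.eval p.1.1.1 p.1.1.2 p.2 - F.eval p.1.1.1 p.1.1.2 p.1.2))) := by
    have h1 := F.measurable_eval.comp
      (Measurable.prodMk (measurable_fst.comp measurable_fst) measurable_snd :
        Measurable fun p : ((Φ × X) × A) × A => (p.1.1, p.2))
    have h2 := F.measurable_eval.comp
      (measurable_fst : Measurable fun p : ((Φ × X) × A) × A => p.1)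
    exact (measurable_const.div (measurable_const.add (measurable_const.mul
      (measurable_const.max (h1.sub h2))))).ennreal_ofReal
  have he : ∀ s : Set A, MeasurableSet s → Measurable fun p : (Φ × X) × A =>
      exploration q h γ μ (F.eval p.1.1 p.1.2) p.2 s := by
    intro s hs
    simp only [exploration, withDensity_apply _ hs]
    exact hd.lintegral_prod_right'
  refine Measure.measurable_of_measurable_coe _ fun s hs => ?_
  simp only [contAL, Measure.coe_add, Measure.coe_smul, Pi.add_apply, Pi.smul_apply, smul_eq_mul,
    Measure.dirac_apply' _ hs]
  exact ((measurable_const.sub (he _ MeasurableSet.univ)).mul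
    ((measurable_one.indicator hs).comp measurable_snd)).add (he s hs)

/-- `contAL` as a kernel in the regression function, the context and the approximate minimizer. -/
def contALKernel (q h γ : ℝ) (μ : Measure A) [SFinite μ] (F : FunctionClass Φ X A) :
    Kernel ((Φ × X) × A) A where
  toFun p := contAL q h γ μ (F.eval p.1.1 p.1.2) p.2
  measurable' := measurable_contAL q h γ μ F

/-- What the regression oracle has observed: contexts, actions, and the losses of these
actions. -/
def Environment.observe (E : Environment X A S) {t : ℕ} (H : History X A S t) :
    Fin t → X × A × ℝ :=
  fun i => ((H i).1, (H i).2.2, E.loss (H i).2.1 (H i).2.2)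

lemma Environment.measurable_observe (E : Environment X A S) (t : ℕ) :
    Measurable (E.observe : History X A S t → Fin t → X × A × ℝ) := by
  refine measurable_pi_lambda _ fun i => ?_
  have hi : Measurable fun H : History X A S t => H i := measurable_pi_apply i
  exact hi.fst.prodMk (hi.snd.snd.prodMk (E.measurable_loss.comp hi.snd))

/-- The action distribution of the algorithm in round `t` given the history and the context `x`:
obtain a regression function from the regression oracle, then an approximate minimizer `b` from
the optimization oracle with accuracy `1 / (4 θ γ)`, then sample the action from `contAL`. -/
def actionLaw (E : Environment X A S) (F : FunctionClass Φ X A) (O : RegressionOracle Φ X A)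
    (P : OptimizationOracle Φ X A) (μ : Measure A) [SFinite μ] (q h γ : ℝ) (t : ℕ) :
    Kernel (History X A S t × X) A :=
  (contALKernel q h γ μ F ∘ₖ (Kernel.id ×ₖ P.choose (1 / (4 * theta q * γ)))).comap
    (fun p : History X A S t × X => (O.predict t (E.observe p.1) p.2, p.2))
    (((O.measurable_predict t).comp
      (((E.measurable_observe t).comp measurable_fst).prodMk measurable_snd)).prodMk
        measurable_snd)

/-- One round: the context, and then, independently given the history and the context, the loss
function and the action. -/
def roundLaw (E : Environment X A S) (F : FunctionClass Φ X A) (O : RegressionOracle Φ X A)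
    (P : OptimizationOracle Φ X A) (μ : Measure A) [SFinite μ] (q h γ : ℝ) (t : ℕ) :
    Kernel (History X A S t) (X × S × A) :=
  E.context t ⊗ₖ (E.lossLaw t ×ₖ actionLaw E F O P μ q h γ t)

/-- The law of the history of the first `t` rounds when the algorithm plays against the
environment. -/
def historyLaw (E : Environment X A S) (F : FunctionClass Φ X A) (O : RegressionOracle Φ X A)
    (P : OptimizationOracle Φ X A) (μ : Measure A) [SFinite μ] (q h γ : ℝ) :
    (t : ℕ) → Measure (History X A S t)
  | 0 => Measure.dirac Fin.elim0
  | t + 1 => (historyLaw E F O P μ q h γ t ⊗ₘ roundLaw E F O P μ q h γ t).map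
      fun p => Fin.snoc (α := fun _ => X × S × A) p.1 p.2

/-! ### Smoothed regret -/

/-- The action distributions `Q` with `dQ/dμ ≤ 1/h`. -/
def smoothComparators (μ : Measure A) (h : ℝ) : Set (Measure A) :=
  {Q | IsProbabilityMeasure Q ∧ Q ≪ μ ∧ ∀ᵐ a ∂μ, Q.rnDeriv μ a ≤ ENNReal.ofReal (1 / h)}

/-- The smoothed conditional regret of round `t` given the history and the context `x`. -/
def roundRegret (E : Environment X A S) (F : FunctionClass Φ X A) (O : RegressionOracle Φ X A)
    (P : OptimizationOracle Φ X A) (μ : Measure A) [SFinite μ] (q h γ : ℝ) (t : ℕ)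
    (H : History X A S t) (x : X) : ℝ :=
  (∫ a, EVaR q (E.lossDist t H x a) ∂(actionLaw E F O P μ q h γ t (H, x)))
    - ⨅ Q : smoothComparators μ h, ∫ a, EVaR q (E.lossDist t H x a) ∂(Q : Measure A)

/-- The smoothed conditional regret over `T` rounds, as a function of the realized history. -/
def regret (E : Environment X A S) (F : FunctionClass Φ X A) (O : RegressionOracle Φ X A)
    (P : OptimizationOracle Φ X A) (μ : Measure A) [SFinite μ] (q h γ : ℝ) (T : ℕ)
    (H : History X A S T) : ℝ :=
  ∑ t : Fin T, roundRegret E F O P μ q h γ t (fun i => H (Fin.castLE t.isLt.le i)) (H t).1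

/-- The expectation of the regret over the interaction of algorithm and environment exists and is
at most `B`. -/
def ExpectedRegretLE (E : Environment X A S) (F : FunctionClass Φ X A)
    (O : RegressionOracle Φ X A) (P : OptimizationOracle Φ X A) (μ : Measure A) [SFinite μ]
    (q h γ : ℝ) (T : ℕ) (B : ℝ) : Prop :=
  Integrable (regret E F O P μ q h γ T) (historyLaw E F O P μ q h γ T) ∧
    ∫ H, regret E F O P μ q h γ T H ∂(historyLaw E F O P μ q h γ T) ≤ B

end Setting

end RiskCB

end

namespace RiskCB

/-! The regret of each round is traded against the squared error of the regression function, and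
that error against the excess expectile loss, whose sum the regression oracle controls. Write `κ =
4θγ`.

Estimation: the expectile loss is `θ (v - w)²` plus a convex function of `w`, so its expectation
grows by at least `θ` times the squared distance to the minimizer. By realizability `f*` is the
conditional expectile, so given history, context and action the expected excess loss of the
prediction over `f*` is at least `θ (f̂ - f*)²` (`theta_mul_sq_le_excess`).

Decision: for any comparator with density at most `1/h`, weighted AM-GM turns the prediction error
into `κ/4` times the squared error under the played distribution, plus a variance term. The density
`1/(1 + κ h (f̂(a) - f̂(b))₊)` is chosen so that this term is cancelled by the predicted gap up to
`2/(κh)` (`density_mul_sub_le`, `contAL_regret_le`). The optimization oracle has accuracy `1/κ`, and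
smoothness of the comparator magnifies its error by `1/h`, giving `3/(κh)` in total
(`roundRegret_le`).

Since `κ/4 = θγ`, the conditional regret of a round is at most `3/(κh) + γ · (expected excess
loss)`. Summing and using the pathwise oracle bound gives `3T/(κh) + γR` (`expectedRegretLE`); both
claims then follow by inserting `γ`.

Integrability needs the infimum over comparators to be measurable in the context. The infimum is
over a possibly uncountable family, so it is replaced by its dual, a supremum over rational
thresholds `c` of `c - (1/h) ∫ (c - f)₊ dμ` (`iInf_smoothComparators_eq_iSup`). -/

lemma theta_pos {q : ℝ} (hq0 : 0 < q) (hq1 : q < 1) : 0 < theta q :=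
  lt_min hq0 (by linarith)

/-! ### Integrals of bounded functions -/

lemma integrable_of_forall_abs_le {Ω : Type*} [MeasurableSpace Ω] {ν : Measure Ω}
    [IsFiniteMeasure ν] {f : Ω → ℝ} (hf : Measurable f) {C : ℝ} (hC : ∀ a, |f a| ≤ C) :
    Integrable f ν :=
  Integrable.of_bound hf.aestronglyMeasurable C (ae_of_all _ fun a => hC a)

lemma integrable_of_forall_mem_Icc {Ω : Type*} [MeasurableSpace Ω] {ν : Measure Ω}
    [IsFiniteMeasure ν] {f : Ω → ℝ} (hf : Measurable f) (h01 : ∀ a, f a ∈ Icc (0 : ℝ) 1) :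
    Integrable f ν :=
  integrable_of_forall_abs_le hf (C := 1) fun a => abs_le.2 ⟨by linarith [(h01 a).1], (h01 a).2⟩

lemma integral_mem_Icc {Ω : Type*} [MeasurableSpace Ω] (ν : Measure Ω) [IsProbabilityMeasure ν]
    {f : Ω → ℝ} (hf : Measurable f) (h01 : ∀ a, f a ∈ Icc (0 : ℝ) 1) :
    ∫ a, f a ∂ν ∈ Icc (0 : ℝ) 1 := by
  refine ⟨integral_nonneg fun a => (h01 a).1, ?_⟩
  have := integral_mono (integrable_of_forall_mem_Icc hf h01) (integrable_const (μ := ν) (1 : ℝ))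
    fun a => (h01 a).2
  simpa using this

/-! ### The expectile loss -/

lemma continuous_expectileLoss (q : ℝ) :
    Continuous fun p : ℝ × ℝ => expectileLoss q p.1 p.2 := by
  unfold expectileLoss; fun_prop

lemma sq_max_le_one {x : ℝ} (hx : x ≤ 1) : max x 0 ^ 2 ≤ 1 := by
  have h1 : 0 ≤ max x 0 := le_max_right _ _
  have h2 : max x 0 ≤ 1 := max_le hx zero_le_one
  nlinarith

lemma expectileLoss_mem_Icc {q : ℝ} (hq0 : 0 < q) (hq1 : q < 1) {v w : ℝ}
    (hv : v ∈ Icc (0 : ℝ) 1) (hw : w ∈ Icc (0 : ℝ) 1) :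
    expectileLoss q v w ∈ Icc (0 : ℝ) 1 := by
  have h1 := sq_max_le_one (x := v - w) (by linarith [hv.2, hw.1])
  have h2 := sq_max_le_one (x := w - v) (by linarith [hv.1, hw.2])
  have h3 := sq_nonneg (max (v - w) 0)
  have h4 := sq_nonneg (max (w - v) 0)
  unfold expectileLoss
  constructor <;> nlinarith

/-- The two squared hinges add up to `(v - w)²`, so the smaller weight `θ` can be split off as a
full quadratic. What remains has nonnegative coefficients; this is the source of strong convexity.
-/
lemma expectileLoss_eq (q v w : ℝ) :
    expectileLoss q v w = theta q * (v - w) ^ 2 + (1 - q - theta q) * max (v - w) 0 ^ 2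
      + (q - theta q) * max (w - v) 0 ^ 2 := by
  unfold expectileLoss
  rcases le_total v w with h | h
  · rw [max_eq_right (by linarith : v - w ≤ 0), max_eq_left (by linarith : 0 ≤ w - v)]; ring
  · rw [max_eq_left (by linarith : 0 ≤ v - w), max_eq_right (by linarith : w - v ≤ 0)]; ring

lemma sq_max_convex {x y s : ℝ} (hs0 : 0 ≤ s) (hs1 : s ≤ 1) :
    max ((1 - s) * x + s * y) 0 ^ 2 ≤ (1 - s) * max x 0 ^ 2 + s * max y 0 ^ 2 := by
  have hx := le_max_left x 0
  have hx0 := le_max_right x 0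
  have hy := le_max_left y 0
  have hy0 := le_max_right y 0
  set X := max x 0
  set Y := max y 0
  have h1 : max ((1 - s) * x + s * y) 0 ≤ (1 - s) * X + s * Y :=
    max_le (by gcongr) (by have := sub_nonneg.2 hs1; positivity)
  have h2 : max ((1 - s) * x + s * y) 0 ^ 2 ≤ ((1 - s) * X + s * Y) ^ 2 :=
    pow_le_pow_left₀ (le_max_right _ _) h1 2
  nlinarith [mul_nonneg (mul_nonneg hs0 (sub_nonneg.2 hs1)) (sq_nonneg (X - Y))]

/-- The quadratic part of `expectileLoss_eq` satisfies this with equality, and the hinge squares are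
convex. -/
lemma expectileLoss_strongly_convex {q v w w' s : ℝ} (hs0 : 0 ≤ s) (hs1 : s ≤ 1) :
    expectileLoss q v ((1 - s) * w + s * w') ≤
      (1 - s) * expectileLoss q v w + s * expectileLoss q v w'
        - theta q * (s * (1 - s) * (w' - w) ^ 2) := by
  have h1 := sq_max_convex (x := v - w) (y := v - w') hs0 hs1
  have h2 := sq_max_convex (x := w - v) (y := w' - v) hs0 hs1
  have e1 : (1 - s) * (v - w) + s * (v - w') = v - ((1 - s) * w + s * w') := by ring
  have e2 : (1 - s) * (w - v) + s * (w' - v) = ((1 - s) * w + s * w') - v := by ring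
  rw [e1] at h1
  rw [e2] at h2
  have h3 : 0 ≤ 1 - q - theta q := sub_nonneg.2 (min_le_right _ _)
  have h4 : 0 ≤ q - theta q := sub_nonneg.2 (min_le_left _ _)
  have h5 := mul_le_mul_of_nonneg_left h1 h3
  have h6 := mul_le_mul_of_nonneg_left h2 h4
  rw [expectileLoss_eq, expectileLoss_eq, expectileLoss_eq]
  linear_combination h5 + h6

section Loss

variable {Ω : Type*} [MeasurableSpace Ω] {ν : Measure Ω} [IsProbabilityMeasure ν] {q : ℝ}
  {V : Ω → ℝ}

lemma integrable_expectileLoss (hq0 : 0 < q) (hq1 : q < 1) (hV : Measurable V)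
    (hV01 : ∀ s, V s ∈ Icc (0 : ℝ) 1) {w : ℝ} (hw : w ∈ Icc (0 : ℝ) 1) :
    Integrable (fun s => expectileLoss q (V s) w) ν :=
  integrable_of_forall_mem_Icc
    ((continuous_expectileLoss q).measurable.comp (hV.prodMk measurable_const))
    fun s => expectileLoss_mem_Icc hq0 hq1 (hV01 s) hw

omit [IsProbabilityMeasure ν] in
lemma integral_expectileLoss_map (hV : Measurable V) (w : ℝ) :
    ∫ v, expectileLoss q v w ∂(ν.map V) = ∫ s, expectileLoss q (V s) w ∂ν :=
  integral_map hV.aemeasurable ((continuous_expectileLoss q).comp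
    (continuous_id.prodMk continuous_const)).measurable.aestronglyMeasurable

/-- The expected loss is continuous in the prediction by dominated convergence, so it attains its
minimum on `[0, 1]` and the `epsilon` in `EVaR` picks a genuine minimizer. -/
lemma isExpectile_EVaR (hq0 : 0 < q) (hq1 : q < 1) (hV : Measurable V)
    (hV01 : ∀ s, V s ∈ Icc (0 : ℝ) 1) : IsExpectile q (ν.map V) (EVaR q (ν.map V)) := by
  refine Classical.epsilon_spec (p := IsExpectile q (ν.map V)) ?_
  have hc : ContinuousOn (fun w => ∫ v, expectileLoss q v w ∂(ν.map V)) (Icc 0 1) := by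
    simp only [integral_expectileLoss_map hV]
    refine continuousOn_of_dominated (bound := fun _ => (1 : ℝ))
      (fun w hw => (integrable_expectileLoss hq0 hq1 hV hV01 hw).aestronglyMeasurable)
      (fun w hw => ae_of_all _ fun s => ?_) (integrable_const _) (ae_of_all _ fun s => ?_)
    · have := expectileLoss_mem_Icc hq0 hq1 (hV01 s) hw
      rw [Real.norm_eq_abs, abs_of_nonneg this.1]
      exact this.2
    · exact ((continuous_expectileLoss q).comp
        (continuous_const.prodMk continuous_id)).continuousOn
  obtain ⟨w, hw, hmin⟩ := isCompact_Icc.exists_isMinOn (nonempty_Icc.2 zero_le_one) hc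
  exact ⟨w, hw, hmin⟩

/-- The excess expectile loss controls the squared distance to the expectile. -/
lemma theta_mul_sq_le_excess (hq0 : 0 < q) (hq1 : q < 1) (hV : Measurable V)
    (hV01 : ∀ s, V s ∈ Icc (0 : ℝ) 1) {w : ℝ} (hw : w ∈ Icc (0 : ℝ) 1) :
    theta q * (w - EVaR q (ν.map V)) ^ 2 ≤
      ∫ s, (expectileLoss q (V s) w - expectileLoss q (V s) (EVaR q (ν.map V))) ∂ν := by
  obtain ⟨hm, hmin⟩ := isExpectile_EVaR (ν := ν) hq0 hq1 hV hV01
  set m := EVaR q (ν.map V)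
  have hiw := integrable_expectileLoss (ν := ν) hq0 hq1 hV hV01 hw
  have him := integrable_expectileLoss (ν := ν) hq0 hq1 hV hV01 hm
  rw [integral_sub hiw him]
  set Lw := ∫ s, expectileLoss q (V s) w ∂ν
  set Lm := ∫ s, expectileLoss q (V s) m ∂ν
  -- Compare the minimizer `m` with the point a fraction `s` of the way to `w`, and divide by `s`.
  -- The claim is the limit `s → 0`.
  have key : ∀ s : ℝ, 0 < s → s ≤ 1 → (1 - s) * (theta q * (w - m) ^ 2) ≤ Lw - Lm := by
    intro s hs0 hs1
    have hmem : (1 - s) * m + s * w ∈ Icc (0 : ℝ) 1 := by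
      have h1 : 0 ≤ 1 - s := by linarith
      constructor
      · have := hm.1; have := hw.1; positivity
      · nlinarith [hm.2, hw.2]
    have h1 : Lm ≤ ∫ u, expectileLoss q (V u) ((1 - s) * m + s * w) ∂ν := by
      simpa only [integral_expectileLoss_map hV] using isMinOn_iff.1 hmin _ hmem
    have h2 := integral_mono
      (integrable_expectileLoss (ν := ν) hq0 hq1 hV hV01 hmem)
      (((him.const_mul (1 - s)).add (hiw.const_mul s)).sub
        (integrable_const (theta q * (s * (1 - s) * (w - m) ^ 2))))
      (fun u => expectileLoss_strongly_convex (q := q) (v := V u) (w := m) (w' := w) hs0.le hs1)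
    have h3 : ∫ u, ((((fun u => (1 - s) * expectileLoss q (V u) m) +
        fun u => s * expectileLoss q (V u) w) -
        fun _ => theta q * (s * (1 - s) * (w - m) ^ 2)) : Ω → ℝ) u ∂ν =
        (1 - s) * Lm + s * Lw - theta q * (s * (1 - s) * (w - m) ^ 2) := by
      rw [integral_sub' ((him.const_mul _).add (hiw.const_mul _)) (integrable_const _),
        integral_add' (him.const_mul _) (hiw.const_mul _), integral_const_mul,
        integral_const_mul]
      simp [Lw, Lm]
    rw [h3] at h2
    have h4 : s * ((1 - s) * (theta q * (w - m) ^ 2)) ≤ s * (Lw - Lm) := by linarith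
    exact le_of_mul_le_mul_left h4 hs0
  by_contra! hlt
  set D := theta q * (w - m) ^ 2
  have h0 : 0 ≤ Lw - Lm := by simpa using key 1 one_pos le_rfl
  have hD : 0 < D := h0.trans_lt hlt
  -- In place of the limit: this `s` makes `(1 - s) D` the midpoint of `D` and `Lw - Lm`, which
  -- exceeds `Lw - Lm` if the claim fails.
  have := key ((D - (Lw - Lm)) / (2 * D)) (by apply div_pos <;> linarith)
    (by rw [div_le_one (by linarith)]; linarith)
  have h5 : (1 - (D - (Lw - Lm)) / (2 * D)) * D = (D + (Lw - Lm)) / 2 := by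
    field_simp; ring
  linarith

end Loss

/-! ### The exploration distribution -/

section Exploration

variable {A : Type*} [MeasurableSpace A] {μ : Measure A} [IsProbabilityMeasure μ]
  {q h γ : ℝ} {f : A → ℝ}

lemma measurable_explorationDensity (hf : Measurable f) (k c : ℝ) :
    Measurable fun a => 1 / (1 + k * max 0 (f a - c)) := by fun_prop

lemma explorationDensity_mem_Icc {k : ℝ} (hk : 0 ≤ k) (x : ℝ) :
    1 / (1 + k * max 0 x) ∈ Icc (0 : ℝ) 1 := by
  have : 0 ≤ k * max 0 x := mul_nonneg hk (le_max_left _ _)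
  refine ⟨by positivity, ?_⟩
  rw [div_le_one (by linarith)]; linarith

lemma exploration_univ (hf : Measurable f) (hk : 0 ≤ 4 * theta q * γ * h) (b : A) :
    exploration q h γ μ f b univ =
      ENNReal.ofReal (∫ a, 1 / (1 + 4 * theta q * γ * h * max 0 (f a - f b)) ∂μ) := by
  rw [exploration, withDensity_apply _ MeasurableSet.univ, Measure.restrict_univ,
    ofReal_integral_eq_lintegral_ofReal]
  · exact integrable_of_forall_mem_Icc (measurable_explorationDensity hf _ _)
      fun a => explorationDensity_mem_Icc hk _
  · exact ae_of_all _ fun a => (explorationDensity_mem_Icc hk _).1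

lemma exploration_univ_le_one (hf : Measurable f) (hk : 0 ≤ 4 * theta q * γ * h) (b : A) :
    exploration q h γ μ f b univ ≤ 1 := by
  rw [exploration_univ hf hk]
  exact ENNReal.ofReal_le_one.2 (integral_mem_Icc μ (measurable_explorationDensity hf _ _)
    fun a => explorationDensity_mem_Icc hk _).2

lemma isProbabilityMeasure_contAL (hf : Measurable f) (hk : 0 ≤ 4 * theta q * γ * h) (b : A) :
    IsProbabilityMeasure (contAL q h γ μ f b) := by
  constructor
  simp only [contAL, Measure.coe_add, Measure.coe_smul, Pi.add_apply, Pi.smul_apply, smul_eq_mul,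
    measure_univ, mul_one]
  exact tsub_add_cancel_of_le (exploration_univ_le_one hf hk b)

lemma integral_contAL (hf : Measurable f) (hk : 0 ≤ 4 * theta q * γ * h) (b : A) {g : A → ℝ}
    (hg : Measurable g) {C : ℝ} (hC : ∀ a, |g a| ≤ C) :
    ∫ a, g a ∂(contAL q h γ μ f b) =
      (1 - ∫ a, 1 / (1 + 4 * theta q * γ * h * max 0 (f a - f b)) ∂μ) * g b +
        ∫ a, 1 / (1 + 4 * theta q * γ * h * max 0 (f a - f b)) * g a ∂μ := by
  have hle := exploration_univ_le_one (μ := μ) hf hk b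
  have : IsFiniteMeasure (exploration q h γ μ f b) :=
    ⟨hle.trans_lt ENNReal.one_lt_top⟩
  have hM := integral_mem_Icc μ (measurable_explorationDensity hf (4 * theta q * γ * h) (f b))
    fun a => explorationDensity_mem_Icc hk _
  rw [contAL, integral_add_measure, integral_smul_measure, integral_dirac' _ _ hg.stronglyMeasurable]
  · congr 1
    · rw [exploration_univ hf hk, ENNReal.toReal_sub_of_le (ENNReal.ofReal_le_one.2 hM.2)
        ENNReal.one_ne_top, ENNReal.toReal_ofReal hM.1, ENNReal.toReal_one, smul_eq_mul]
    · rw [exploration, integral_withDensity_eq_integral_toReal_smul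
        (measurable_explorationDensity hf _ _).ennreal_ofReal
        (ae_of_all _ fun a => ENNReal.ofReal_lt_top)]
      refine integral_congr_ae (ae_of_all _ fun a => ?_)
      simp only [smul_eq_mul]
      rw [ENNReal.toReal_ofReal (explorationDensity_mem_Icc hk _).1]
  · exact (integrable_of_forall_abs_le hg hC).smul_measure
      (ENNReal.sub_ne_top ENNReal.one_ne_top)
  · exact integrable_of_forall_abs_le hg hC

/-- Pointwise form of the decision estimate: `r` is the comparator density, `x` and `c` are the
predictions at the action and at the approximate minimizer, and `e` is the prediction error. -/
lemma density_mul_sub_le {κ h r x e c : ℝ} (hκ : 0 < κ) (hh : 0 < h) (hr0 : 0 ≤ r)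
    (hr1 : r ≤ 1 / h) :
    (r - 1 / (1 + κ * h * max 0 (x - c))) * e
        + 1 / (1 + κ * h * max 0 (x - c)) * (x - c) + r * (c - x)
      ≤ κ / 4 * (1 / (1 + κ * h * max 0 (x - c)) * e ^ 2)
        + r * (1 / (κ * h) - 2 / κ) + 1 / (1 + κ * h * max 0 (x - c)) * (1 / κ)
        + 1 / (κ * h) + max 0 (c - x) * (1 / h) := by
  have hu0 : 0 ≤ max 0 (x - c) := le_max_left _ _
  have hd0 : 0 ≤ max 0 (c - x) := le_max_left _ _
  have hud : x - c = max 0 (x - c) - max 0 (c - x) := by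
    rcases le_total x c with h | h
    · rw [max_eq_left (by linarith : x - c ≤ 0), max_eq_right (by linarith : 0 ≤ c - x)]; ring
    · rw [max_eq_right (by linarith : 0 ≤ x - c), max_eq_left (by linarith : c - x ≤ 0)]; ring
  have hcx : c - x = max 0 (c - x) - max 0 (x - c) := by linarith
  set u := max 0 (x - c)
  set d := max 0 (c - x)
  have hn : 0 < 1 + κ * h * u := by positivity
  obtain ⟨n, hnd⟩ : ∃ n, n = 1 + κ * h * u := ⟨_, rfl⟩
  rw [← hnd] at hn ⊢
  -- AM-GM weighted by the played density `1/n`; the last fraction is `(r - 1/n)² / (κ/n)`.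
  have h1 : (r - 1 / n) * e ≤ κ / 4 * (1 / n * e ^ 2) + (r ^ 2 * n - 2 * r + 1 / n) / κ := by
    have : κ / 4 * (1 / n * e ^ 2) + (r ^ 2 * n - 2 * r + 1 / n) / κ - (r - 1 / n) * e
        = (κ * e / 2 - (r * n - 1)) ^ 2 / (n * κ) := by
      field_simp; ring
    have h2 : 0 ≤ (κ * e / 2 - (r * n - 1)) ^ 2 / (n * κ) := by positivity
    linarith
  -- Here `r ≤ 1/h` is spent. The resulting `r * u` is the predicted advantage of `c` under the
  -- comparator, and cancels against `r * (c - x)`.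
  have h2 : r ^ 2 * n / κ ≤ r / (κ * h) + r * u := by
    have : r ^ 2 * n / κ ≤ r * (1 / h) * n / κ := by
      rw [pow_two]; gcongr
    have h3 : r * (1 / h) * n / κ = r / (κ * h) + r * u := by rw [hnd]; field_simp
    linarith
  have h3 : 1 / n * u ≤ 1 / (κ * h) := by
    rw [one_div_mul_eq_div, div_le_div_iff₀ hn (by positivity)]; linarith
  have h4 : 0 ≤ 1 / n * d := by positivity
  have h5 : r * d ≤ d * (1 / h) := by rw [mul_comm]; gcongr
  have h6 : (r ^ 2 * n - 2 * r + 1 / n) / κ = r ^ 2 * n / κ - r * (2 / κ) + 1 / n * (1 / κ) := by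
    ring
  rw [hcx, hud]
  have h7 : r / (κ * h) = r * (1 / (κ * h)) := by ring
  linarith

/-- The regret of the exploration distribution against a smooth comparator, for a fixed
approximate minimizer `b` of the regression function `f`. -/
lemma contAL_regret_le (hκ : 0 < 4 * theta q * γ) (hh : 0 < h) (hf : Measurable f)
    (hf01 : ∀ a, f a ∈ Icc (0 : ℝ) 1) {g : A → ℝ} (hg : Measurable g)
    (hg01 : ∀ a, g a ∈ Icc (0 : ℝ) 1) (b : A) {Q : Measure A} (hQ : Q ∈ smoothComparators μ h) :
    ∫ a, g a ∂(contAL q h γ μ f b) - ∫ a, g a ∂Q ≤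
      2 / (4 * theta q * γ * h)
        + 4 * theta q * γ / 4 * ∫ a, (f a - g a) ^ 2 ∂(contAL q h γ μ f b)
        + 1 / h * ∫ a, max 0 (f b - f a) ∂μ := by
  obtain ⟨hQp, hQμ, hQd⟩ := hQ
  obtain ⟨κ, hκe⟩ : ∃ κ, κ = 4 * theta q * γ := ⟨_, rfl⟩
  have hk : 0 ≤ 4 * theta q * γ * h := by positivity
  have hgC : ∀ a, |g a| ≤ 1 := fun a => abs_le.2 ⟨by linarith [(hg01 a).1], (hg01 a).2⟩
  have heC : ∀ a, |f a - g a| ≤ 1 := fun a =>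
    abs_le.2 ⟨by linarith [(hf01 a).1, (hg01 a).2], by linarith [(hf01 a).2, (hg01 a).1]⟩
  have he2m : Measurable fun a => (f a - g a) ^ 2 := (hf.sub hg).pow_const 2
  have he2C : ∀ a, |(f a - g a) ^ 2| ≤ 1 := fun a => by
    rw [abs_pow]; exact pow_le_one₀ (abs_nonneg _) (heC a)
  rw [integral_contAL hf hk b hg hgC,
    integral_contAL hf hk b he2m he2C]
  rw [← hκe] at hκ hk ⊢
  set m : A → ℝ := fun a => 1 / (1 + κ * h * max 0 (f a - f b)) with hm
  set r : A → ℝ := fun a => (Q.rnDeriv μ a).toReal with hr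
  have hmm : Measurable m := measurable_explorationDensity hf _ _
  have hm01 : ∀ a, m a ∈ Icc (0 : ℝ) 1 := fun a => explorationDensity_mem_Icc hk _
  have hmi : Integrable m μ := integrable_of_forall_mem_Icc hmm hm01
  have hM := integral_mem_Icc μ hmm hm01
  have hri : Integrable r μ := Measure.integrable_toReal_rnDeriv
  have hr1 : ∫ a, r a ∂μ = 1 := by
    have := Measure.integral_toReal_rnDeriv hQμ
    simpa using this
  have hQi : ∫ a, g a ∂Q = ∫ a, r a * g a ∂μ := by
    have := integral_rnDeriv_smul hQμ (f := g)
    simp only [smul_eq_mul] at this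
    exact this.symm
  have hbd : ∀ {p : A → ℝ}, Integrable p μ → ∀ {w : A → ℝ}, Measurable w → ∀ {C : ℝ},
      (∀ a, |w a| ≤ C) → Integrable (fun a => p a * w a) μ := fun hp w hw C hC =>
    hp.mul_bdd hw.aestronglyMeasurable (ae_of_all _ hC)
  have hfb : ∀ a, |f a - f b| ≤ 1 := fun a =>
    abs_le.2 ⟨by linarith [(hf01 a).1, (hf01 b).2], by linarith [(hf01 a).2, (hf01 b).1]⟩
  have hd01 : ∀ a, max 0 (f b - f a) ∈ Icc (0 : ℝ) 1 := fun a =>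
    ⟨le_max_left _ _, max_le zero_le_one (by linarith [(hf01 b).2, (hf01 a).1])⟩
  have hdm : Measurable fun a => max 0 (f b - f a) :=
    measurable_const.max (measurable_const.sub hf)
  have i1 := hbd hmi hg hgC
  have i2 := hbd hri hg hgC
  have i3 := hbd hmi he2m he2C
  have i4 : Integrable (fun a => max 0 (f b - f a)) μ := integrable_of_forall_mem_Icc hdm hd01
  -- The left side of `density_mul_sub_le` with `e = f a - g a` collapses to this. After integration
  -- `f b` carries the factor `1 - M`, the mass of the atom at `b`.
  have hae : ∀ᵐ a ∂μ, m a * g a - r a * g a + (f b) * (r a - m a) ≤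
      κ / 4 * (m a * (f a - g a) ^ 2) + r a * (1 / (κ * h) - 2 / κ) + m a * (1 / κ)
        + 1 / (κ * h) + max 0 (f b - f a) * (1 / h) := by
    filter_upwards [hQd] with a ha
    have hra : r a ≤ 1 / h := by
      have := ENNReal.toReal_mono ENNReal.ofReal_ne_top ha
      rwa [ENNReal.toReal_ofReal (by positivity)] at this
    have := density_mul_sub_le (x := f a) (e := f a - g a) (c := f b) hκ hh
      ENNReal.toReal_nonneg hra
    simp only [hm, hr] at this ⊢
    linarith
  have hint := integral_mono_ae ((i1.sub i2).add ((hri.sub hmi).const_mul (f b)))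
    (((((i3.const_mul (κ / 4)).add (hri.mul_const (1 / (κ * h) - 2 / κ))).add
      (hmi.mul_const (1 / κ))).add (integrable_const (1 / (κ * h)))).add
        (i4.mul_const (1 / h))) hae
  rw [integral_add' (i1.sub i2) ((hri.sub hmi).const_mul (f b)), integral_sub' i1 i2,
    integral_const_mul, integral_sub' hri hmi, hr1,
    integral_add' ((((i3.const_mul (κ / 4)).add (hri.mul_const (1 / (κ * h) - 2 / κ))).add
      (hmi.mul_const (1 / κ))).add (integrable_const (1 / (κ * h)))) (i4.mul_const (1 / h)),
    integral_add' (((i3.const_mul (κ / 4)).add (hri.mul_const (1 / (κ * h) - 2 / κ))).add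
      (hmi.mul_const (1 / κ))) (integrable_const (1 / (κ * h))),
    integral_add' ((i3.const_mul (κ / 4)).add (hri.mul_const (1 / (κ * h) - 2 / κ)))
      (hmi.mul_const (1 / κ)),
    integral_add' (i3.const_mul (κ / 4)) (hri.mul_const (1 / (κ * h) - 2 / κ)),
    integral_const_mul, integral_mul_const, integral_mul_const, integral_mul_const, hr1] at hint
  simp only [integral_const, probReal_univ, one_smul] at hint
  rw [hQi]
  set M := ∫ a, m a ∂μ
  -- The atom gets its own AM-GM. Its cost `(1 - M)/κ` and the `M/κ` of the continuous part are both
  -- paid by the `-2/κ` in `hint`.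
  have hb : (1 - M) * (g b - f b) ≤ κ / 4 * ((1 - M) * (f b - g b) ^ 2) + (1 - M) * (1 / κ) := by
    have h1 : (g b - f b) ≤ κ / 4 * (f b - g b) ^ 2 + 1 / κ := by
      have : κ / 4 * (f b - g b) ^ 2 + 1 / κ - (g b - f b)
          = (κ * (f b - g b) / 2 + 1) ^ 2 / κ := by field_simp; ring
      have h2 : 0 ≤ (κ * (f b - g b) / 2 + 1) ^ 2 / κ := by positivity
      linarith
    have := mul_le_mul_of_nonneg_left h1 (sub_nonneg.2 hM.2)
    linarith
  have hκ' : 0 < 1 / κ := by positivity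
  have e1 : 2 / (κ * h) = 1 / (κ * h) + 1 / (κ * h) := by ring
  have e2 : 2 / κ = 1 / κ + 1 / κ := by ring
  rw [e1]
  rw [e2] at hint
  linarith

end Exploration

/-! ### Smooth comparators: the best value and its dual -/

section Comparators

variable {A : Type*} [MeasurableSpace A] {μ : Measure A} [IsProbabilityMeasure μ]
  {h : ℝ} {f : A → ℝ}

-- The infimum of the points where the distribution function reaches `h` works: the left limit there
-- is at most `h`, and right continuity gives the other inequality.
open Filter Topology in
lemma exists_quantile (ν : Measure ℝ) [IsProbabilityMeasure ν] (hν : ν.real (Icc 0 1) = 1)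
    (hh0 : 0 < h) (hh1 : h ≤ 1) : ∃ c, ν.real (Iio c) ≤ h ∧ h ≤ ν.real (Iic c) := by
  set S := {c | h ≤ cdf ν c} with hS
  have h1 : (1 : ℝ) ∈ S := by
    have : ν.real (Icc 0 1) ≤ ν.real (Iic 1) := measureReal_mono Icc_subset_Iic_self
    rw [hS, mem_ofPred_eq, cdf_eq_real]; linarith
  have hbd : ∀ c ∈ S, 0 ≤ c := by
    intro c hc
    by_contra! hneg
    have hd : Disjoint (Icc (0 : ℝ) 1) (Iic c) :=
      Set.disjoint_left.2 fun x hx hx' => by linarith [hx.1, mem_Iic.1 hx']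
    have hu := measureReal_union (μ := ν) hd measurableSet_Iic
    have hle : ν.real (Icc 0 1 ∪ Iic c) ≤ 1 := measureReal_le_one
    rw [hS, mem_ofPred_eq, cdf_eq_real] at hc
    linarith
  have hB : BddBelow S := ⟨0, hbd⟩
  refine ⟨sInf S, ?_, ?_⟩
  · have hlt : ∀ c < sInf S, cdf ν c ≤ h := fun c hc =>
      (not_le.1 fun hle => notMem_of_lt_csInf hc hB hle).le
    have hl : Function.leftLim (cdf ν) (sInf S) ≤ h :=
      le_of_tendsto ((monotone_cdf ν).tendsto_leftLim _)
        (eventually_nhdsWithin_of_forall fun c hc => hlt c hc)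
    have h2 := (cdf ν).measure_Iio (tendsto_cdf_atBot ν) (sInf S)
    rw [measure_cdf, sub_zero] at h2
    rw [measureReal_def, h2]
    exact ENNReal.toReal_le_of_le_ofReal hh0.le (ENNReal.ofReal_le_ofReal hl)
  · rw [← cdf_eq_real]
    have hgt : ∀ c > sInf S, h ≤ cdf ν c := fun c hc => by
      obtain ⟨s, hs, hsc⟩ := exists_lt_of_csInf_lt ⟨1, h1⟩ hc
      exact le_trans hs (monotone_cdf ν hsc.le)
    have ht : Tendsto (cdf ν) (𝓝[>] (sInf S)) (𝓝 (cdf ν (sInf S))) :=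
      ((cdf ν).right_continuous _).mono_left (nhdsWithin_mono _ Ioi_subset_Ici_self)
    exact ge_of_tendsto ht (eventually_nhdsWithin_of_forall fun c hc => hgt c hc)

lemma withDensity_mem_smoothComparators {r : A → ℝ} (hr : Measurable r) (hr0 : ∀ a, 0 ≤ r a)
    (hr1 : ∀ a, r a ≤ 1 / h) (hri : Integrable r μ) (hrint : ∫ a, r a ∂μ = 1) :
    μ.withDensity (fun a => ENNReal.ofReal (r a)) ∈ smoothComparators μ h := by
  refine ⟨⟨?_⟩, withDensity_absolutelyContinuous _ _, ?_⟩
  · rw [withDensity_apply _ MeasurableSet.univ, Measure.restrict_univ,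
      ← ofReal_integral_eq_lintegral_ofReal hri (ae_of_all _ hr0), hrint, ENNReal.ofReal_one]
  · filter_upwards [Measure.rnDeriv_withDensity μ hr.ennreal_ofReal] with a ha
    rw [ha]
    exact ENNReal.ofReal_le_ofReal (hr1 a)

lemma self_mem_smoothComparators (hh0 : 0 < h) (hh1 : h ≤ 1) : μ ∈ smoothComparators μ h := by
  have := withDensity_mem_smoothComparators (μ := μ) (h := h) (r := fun _ => 1) measurable_const
    (fun _ => zero_le_one) (fun _ => by rwa [le_div_iff₀ hh0, one_mul]) (integrable_const _)
    (by simp)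
  simpa using this

lemma integrable_hinge (hf : Measurable f) (hf01 : ∀ a, f a ∈ Icc (0 : ℝ) 1) (c : ℝ) :
    Integrable (fun a => max 0 (c - f a)) μ := by
  refine integrable_of_forall_abs_le (measurable_const.max (measurable_const.sub hf))
    (C := |c|) fun a => ?_
  rw [abs_of_nonneg (le_max_left _ _)]
  exact max_le (abs_nonneg _) (by linarith [(hf01 a).1, le_abs_self c])

/-- Weak duality: a density `r` between `0` and `1/h` satisfies `r (c - f) ≤ (1/h) (c - f)₊`;
integrate. -/
lemma dual_value_le_integral (hh0 : 0 < h) (hf : Measurable f)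
    (hf01 : ∀ a, f a ∈ Icc (0 : ℝ) 1) (c : ℝ) {Q : Measure A} (hQ : Q ∈ smoothComparators μ h) :
    c - 1 / h * ∫ a, max 0 (c - f a) ∂μ ≤ ∫ a, f a ∂Q := by
  obtain ⟨hQp, hQμ, hQd⟩ := hQ
  set r : A → ℝ := fun a => (Q.rnDeriv μ a).toReal with hr
  have hri : Integrable r μ := Measure.integrable_toReal_rnDeriv
  have hr1 : ∫ a, r a ∂μ = 1 := by
    simpa using Measure.integral_toReal_rnDeriv hQμ
  have hQi : ∫ a, f a ∂Q = ∫ a, r a * f a ∂μ := (integral_rnDeriv_smul hQμ (f := f)).symm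
  have hrf : Integrable (fun a => r a * f a) μ :=
    hri.mul_bdd (c := 1) hf.aestronglyMeasurable (ae_of_all _ fun a =>
      abs_le.2 ⟨by linarith [(hf01 a).1], (hf01 a).2⟩)
  have hi := integrable_hinge (μ := μ) hf hf01 c
  have hae : ∀ᵐ a ∂μ, r a * c - 1 / h * max 0 (c - f a) ≤ r a * f a := by
    filter_upwards [hQd] with a ha
    have hra : r a ≤ 1 / h := by
      have := ENNReal.toReal_mono ENNReal.ofReal_ne_top ha
      rwa [ENNReal.toReal_ofReal (by positivity)] at this
    have hr0 : 0 ≤ r a := ENNReal.toReal_nonneg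
    have h1 := mul_le_mul_of_nonneg_right hra (le_max_left 0 (c - f a))
    have h2 := mul_le_mul_of_nonneg_left (le_max_right 0 (c - f a)) hr0
    linarith
  have := integral_mono_ae ((hri.mul_const c).sub (hi.const_mul (1 / h))) hrf hae
  rw [integral_sub' (hri.mul_const c) (hi.const_mul (1 / h)), integral_mul_const,
    integral_const_mul, hr1] at this
  rw [hQi]; linarith

/-- No duality gap: the best comparator puts density `1/h` on the lowest `μ`-fraction `h` of the
values of `f`, cut at an `h`-quantile `c`. It saturates the pointwise inequality of weak duality
everywhere. -/
lemma exists_comparator_eq_dual_value (hh0 : 0 < h) (hh1 : h ≤ 1) (hf : Measurable f)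
    (hf01 : ∀ a, f a ∈ Icc (0 : ℝ) 1) :
    ∃ Q ∈ smoothComparators μ h, ∃ c : ℝ,
      ∫ a, f a ∂Q = c - 1 / h * ∫ a, max 0 (c - f a) ∂μ := by
  have hprob : IsProbabilityMeasure (μ.map f) :=
    Measure.isProbabilityMeasure_map hf.aemeasurable
  obtain ⟨c, hc1, hc2⟩ := exists_quantile (h := h) (μ.map f) (by
    rw [map_measureReal_apply hf measurableSet_Icc]
    have : f ⁻¹' Icc 0 1 = univ := eq_univ_of_forall hf01
    rw [this]; exact probReal_univ) hh0 hh1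
  have hsplit : (μ.map f).real (Iic c) = (μ.map f).real (Iio c) + (μ.map f).real {c} := by
    rw [← Iio_union_right, measureReal_union (by simp) (measurableSet_singleton c)]
  rw [map_measureReal_apply hf measurableSet_Iic, map_measureReal_apply hf measurableSet_Iio,
    map_measureReal_apply hf (measurableSet_singleton c)] at hsplit
  rw [map_measureReal_apply hf measurableSet_Iio] at hc1
  rw [map_measureReal_apply hf measurableSet_Iic] at hc2
  have hL : MeasurableSet (f ⁻¹' Iio c) := hf measurableSet_Iio
  have hE : MeasurableSet (f ⁻¹' {c}) := hf (measurableSet_singleton c)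
  set p := μ.real (f ⁻¹' Iio c)
  set e := μ.real (f ⁻¹' {c})
  have he0 : 0 ≤ e := measureReal_nonneg
  -- The share of the level set `{f = c}` that brings the mass to exactly `h`. If `e = 0`, the
  -- quotient is `0` and the quantile bounds force `p = h`.
  set l := (h - p) / e with hl
  have hl0 : 0 ≤ l := div_nonneg (by linarith) he0
  have hl1 : l ≤ 1 := div_le_one_of_le₀ (by linarith) he0
  have hle : p + l * e = h := by
    rcases he0.eq_or_lt with h0 | h0
    · rw [← h0] at hsplit ⊢; linarith
    · rw [hl, div_mul_cancel₀ _ h0.ne']; ring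
  set r : A → ℝ := fun a =>
    1 / h * ((f ⁻¹' Iio c).indicator 1 a + l * (f ⁻¹' {c}).indicator 1 a) with hr
  have hrm : Measurable r := by
    have h1 : Measurable ((f ⁻¹' Iio c).indicator (1 : A → ℝ)) := measurable_one.indicator hL
    have h2 : Measurable ((f ⁻¹' {c}).indicator (1 : A → ℝ)) := measurable_one.indicator hE
    fun_prop
  have hcases : ∀ a, r a ∈ Icc 0 (1 / h) ∧ r a * f a = r a * c - 1 / h * max 0 (c - f a) := by
    intro a
    have hinv : 0 ≤ 1 / h := by positivity
    simp only [hr]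
    rcases lt_trichotomy (f a) c with h1 | h1 | h1
    · have h2 : a ∈ f ⁻¹' Iio c := h1
      have h3 : a ∉ f ⁻¹' {c} := h1.ne
      rw [indicator_of_mem h2, indicator_of_notMem h3, max_eq_right (by linarith)]
      simp only [Pi.one_apply, mul_zero, add_zero, mul_one]
      exact ⟨⟨hinv, le_rfl⟩, by ring⟩
    · have h2 : a ∉ f ⁻¹' Iio c := fun h' => absurd h1 (ne_of_lt h')
      have h3 : a ∈ f ⁻¹' {c} := h1
      rw [indicator_of_notMem h2, indicator_of_mem h3, max_eq_left (by linarith)]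
      simp only [Pi.one_apply, mul_zero, zero_add, mul_one]
      exact ⟨⟨by positivity, mul_le_of_le_one_right hinv hl1⟩, by rw [h1]; ring⟩
    · have h2 : a ∉ f ⁻¹' Iio c := fun h' => absurd h1 (not_lt.2 (le_of_lt h'))
      have h3 : a ∉ f ⁻¹' {c} := fun h' => absurd h' h1.ne'
      rw [indicator_of_notMem h2, indicator_of_notMem h3, max_eq_left (by linarith)]
      simp only [mul_zero, add_zero]
      exact ⟨⟨le_rfl, hinv⟩, by ring⟩
  have hri : Integrable r μ := integrable_of_forall_abs_le hrm (C := 1 / h) fun a => by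
    rw [abs_of_nonneg (hcases a).1.1]; exact (hcases a).1.2
  have hrint : ∫ a, r a ∂μ = 1 := by
    have i1 : Integrable ((f ⁻¹' Iio c).indicator (1 : A → ℝ)) μ :=
      (integrable_const (1 : ℝ)).indicator hL
    have i2 : Integrable ((f ⁻¹' {c}).indicator (1 : A → ℝ)) μ :=
      (integrable_const (1 : ℝ)).indicator hE
    simp only [hr]
    rw [integral_const_mul, integral_add i1 (i2.const_mul l), integral_const_mul,
      integral_indicator_one hL, integral_indicator_one hE, hle, one_div_mul_cancel hh0.ne']
  refine ⟨_, withDensity_mem_smoothComparators hrm (fun a => (hcases a).1.1)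
    (fun a => (hcases a).1.2) hri hrint, c, ?_⟩
  rw [integral_withDensity_eq_integral_toReal_smul hrm.ennreal_ofReal
    (ae_of_all _ fun a => ENNReal.ofReal_lt_top)]
  have : ∀ a, (ENNReal.ofReal (r a)).toReal • f a = r a * c - 1 / h * max 0 (c - f a) :=
    fun a => by rw [ENNReal.toReal_ofReal (hcases a).1.1, smul_eq_mul, (hcases a).2]
  simp only [this]
  rw [integral_sub (hri.mul_const c) ((integrable_hinge hf hf01 c).const_mul _),
    integral_mul_const, hrint, integral_const_mul, one_mul]

lemma iInf_smoothComparators_eq_iSup (hh0 : 0 < h) (hh1 : h ≤ 1) (hf : Measurable f)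
    (hf01 : ∀ a, f a ∈ Icc (0 : ℝ) 1) :
    ⨅ Q : smoothComparators μ h, ∫ a, f a ∂(Q : Measure A) =
      ⨆ c : ℚ, ((c : ℝ) - 1 / h * ∫ a, max 0 ((c : ℝ) - f a) ∂μ) := by
  have : Nonempty (smoothComparators μ h) := ⟨⟨μ, self_mem_smoothComparators hh0 hh1⟩⟩
  refine le_antisymm ?_ (ciSup_le fun c => le_ciInf fun Q =>
    dual_value_le_integral hh0 hf hf01 c Q.2)
  obtain ⟨Q, hQ, c, hc⟩ := exists_comparator_eq_dual_value (μ := μ) hh0 hh1 hf hf01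
  have hbelow : BddBelow (range fun Q : smoothComparators μ h => ∫ a, f a ∂(Q : Measure A)) :=
    ⟨0, by rintro _ ⟨Q, rfl⟩; exact integral_nonneg fun a => (hf01 a).1⟩
  have habove : BddAbove (range fun c : ℚ =>
      ((c : ℝ) - 1 / h * ∫ a, max 0 ((c : ℝ) - f a) ∂μ)) :=
    ⟨∫ a, f a ∂Q, by rintro _ ⟨c, rfl⟩; exact dual_value_le_integral hh0 hf hf01 c hQ⟩
  refine (ciInf_le hbelow ⟨Q, hQ⟩).trans ?_
  refine le_of_forall_pos_le_add fun ε hε => ?_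
  -- Approximating from below suffices: lowering the threshold decreases the hinge integral, so the
  -- dual value drops by less than `ε`.
  obtain ⟨c', h1, h2⟩ := exists_rat_btwn (show c - ε < c by linarith)
  have h3 := le_ciSup habove c'
  have h4 : ∫ a, max 0 ((c' : ℝ) - f a) ∂μ ≤ ∫ a, max 0 (c - f a) ∂μ :=
    integral_mono (integrable_hinge hf hf01 _) (integrable_hinge hf hf01 _) fun a =>
      max_le_max le_rfl (by linarith)
  have h5 := mul_le_mul_of_nonneg_left h4 (by positivity : 0 ≤ 1 / h)
  simp only [hc]
  linarith

lemma iInf_smoothComparators_mem_Icc (hh0 : 0 < h) (hh1 : h ≤ 1) (hf : Measurable f)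
    (hf01 : ∀ a, f a ∈ Icc (0 : ℝ) 1) :
    ⨅ Q : smoothComparators μ h, ∫ a, f a ∂(Q : Measure A) ∈ Icc (0 : ℝ) 1 := by
  have hμ := self_mem_smoothComparators (μ := μ) hh0 hh1
  have : Nonempty (smoothComparators μ h) := ⟨⟨μ, hμ⟩⟩
  have hbelow : BddBelow (range fun Q : smoothComparators μ h => ∫ a, f a ∂(Q : Measure A)) :=
    ⟨0, by rintro _ ⟨Q, rfl⟩; exact integral_nonneg fun a => (hf01 a).1⟩
  exact ⟨le_ciInf fun Q => integral_nonneg fun a => (hf01 a).1,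
    (ciInf_le hbelow ⟨μ, hμ⟩).trans (integral_mem_Icc μ hf hf01).2⟩

lemma measurable_iInf_smoothComparators {Y : Type*} [MeasurableSpace Y] {f : Y → A → ℝ}
    (hh0 : 0 < h) (hh1 : h ≤ 1) (hf : Measurable fun p : Y × A => f p.1 p.2)
    (hf01 : ∀ y a, f y a ∈ Icc (0 : ℝ) 1) :
    Measurable fun y => ⨅ Q : smoothComparators μ h, ∫ a, f y a ∂(Q : Measure A) := by
  have heq : ∀ y, (⨅ Q : smoothComparators μ h, ∫ a, f y a ∂(Q : Measure A)) =
      ⨆ c : ℚ, ((c : ℝ) - 1 / h * ∫ a, max 0 ((c : ℝ) - f y a) ∂μ) := fun y =>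
    iInf_smoothComparators_eq_iSup hh0 hh1 (hf.comp measurable_prodMk_left) (hf01 y)
  simp only [heq]
  refine Measurable.iSup fun c => measurable_const.sub (measurable_const.mul ?_)
  have : Measurable fun p : Y × A => max 0 ((c : ℝ) - f p.1 p.2) :=
    measurable_const.max (measurable_const.sub hf)
  exact this.stronglyMeasurable.integral_prod_right.measurable

end Comparators

/-! ### The interaction -/

section Interaction

variable {X A S Φ : Type*} [MeasurableSpace X] [MeasurableSpace A] [MeasurableSpace S]
  [MeasurableSpace Φ]
  (E : Environment X A S) (F : FunctionClass Φ X A) (O : RegressionOracle Φ X A)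
  (P : OptimizationOracle Φ X A) (μ : Measure A) [IsProbabilityMeasure μ] {q h γ : ℝ}

lemma FunctionClass.measurable_section (φ : Φ) (x : X) : Measurable (F.eval φ x) :=
  F.measurable_eval.comp (measurable_prodMk_left (x := (φ, x)))

lemma Environment.measurable_loss_left (a : A) : Measurable fun s => E.loss s a :=
  E.measurable_loss.comp measurable_prodMk_right

lemma isMarkovKernel_contALKernel (hk : 0 ≤ 4 * theta q * γ * h) :
    IsMarkovKernel (contALKernel q h γ μ F) :=
  ⟨fun _ => isProbabilityMeasure_contAL (F.measurable_section _ _) hk _⟩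

lemma isMarkovKernel_actionLaw (hk : 0 ≤ 4 * theta q * γ * h) (t : ℕ) :
    IsMarkovKernel (actionLaw E F O P μ q h γ t) := by
  have := isMarkovKernel_contALKernel F μ hk
  unfold actionLaw
  infer_instance

lemma isMarkovKernel_roundLaw (hk : 0 ≤ 4 * theta q * γ * h) (t : ℕ) :
    IsMarkovKernel (roundLaw E F O P μ q h γ t) := by
  have := isMarkovKernel_actionLaw E F O P μ hk t
  unfold roundLaw
  infer_instance

lemma measurable_snoc (t : ℕ) :
    Measurable fun p : History X A S t × (X × S × A) =>
      (Fin.snoc (α := fun _ => X × S × A) p.1 p.2 : History X A S (t + 1)) := by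
  refine measurable_pi_lambda _ fun i => ?_
  induction i using Fin.lastCases with
  | last => simpa only [Fin.snoc_last] using measurable_snd
  | cast i =>
    simp only [Fin.snoc_castSucc]
    exact (measurable_pi_apply i).comp measurable_fst

lemma isProbabilityMeasure_historyLaw (hk : 0 ≤ 4 * theta q * γ * h) (t : ℕ) :
    IsProbabilityMeasure (historyLaw E F O P μ q h γ t) := by
  induction t with
  | zero => unfold historyLaw; infer_instance
  | succ t ih =>
    have := isMarkovKernel_roundLaw E F O P μ hk t
    unfold historyLaw
    exact Measure.isProbabilityMeasure_map (measurable_snoc t).aemeasurable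

/-- The first `t` rounds and round `t` itself, as a function of a longer history. -/
def History.round {T : ℕ} (t : Fin T) (H : History X A S T) :
    History X A S t × (X × S × A) :=
  (fun i => H (Fin.castLE t.isLt.le i), H t)

lemma measurable_round {T : ℕ} (t : Fin T) :
    Measurable (History.round t : History X A S T → _) :=
  (measurable_pi_lambda _ fun _ => measurable_pi_apply _).prodMk (measurable_pi_apply _)

/-- Later rounds are appended by Markov kernels, so forgetting them leaves the law of the earlier
ones. This puts single-round expectations on the common space of full histories. -/
lemma map_round_historyLaw (hk : 0 ≤ 4 * theta q * γ * h) {T : ℕ} (t : Fin T) :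
    (historyLaw E F O P μ q h γ T).map (History.round t) =
      historyLaw E F O P μ q h γ t ⊗ₘ roundLaw E F O P μ q h γ t := by
  induction T with
  | zero => exact t.elim0
  | succ T ih =>
    have := isProbabilityMeasure_historyLaw E F O P μ hk T
    have := isMarkovKernel_roundLaw E F O P μ hk T
    rw [historyLaw, Measure.map_map (measurable_round t) (measurable_snoc T)]
    induction t using Fin.lastCases with
    | last =>
      have hid : (History.round (Fin.last T) ∘ fun p : History X A S T × (X × S × A) =>
          (Fin.snoc (α := fun _ => X × S × A) p.1 p.2 : History X A S (T + 1))) = id := by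
        funext p
        refine Prod.ext (funext fun i => ?_) ?_
        · exact Fin.snoc_castSucc (α := fun _ => X × S × A) p.2 p.1 i
        · exact Fin.snoc_last (α := fun _ => X × S × A) p.2 p.1
      rw [hid]
      exact Measure.map_id
    | cast t =>
      have hcomp : (History.round t.castSucc ∘ fun p : History X A S T × (X × S × A) =>
          (Fin.snoc (α := fun _ => X × S × A) p.1 p.2 : History X A S (T + 1))) =
          History.round t ∘ Prod.fst := by
        funext p
        refine Prod.ext (funext fun i => ?_) ?_
        · exact Fin.snoc_castSucc (α := fun _ => X × S × A) p.2 p.1 (Fin.castLE t.isLt.le i)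
        · exact Fin.snoc_castSucc (α := fun _ => X × S × A) p.2 p.1 t
      rw [hcomp, ← Measure.map_map (measurable_round t) measurable_fst, ← Measure.fst,
        Measure.fst_compProd]
      exact ih t

lemma le_integral_of_forall_le {Ω : Type*} [MeasurableSpace Ω] {ν : Measure Ω}
    [IsProbabilityMeasure ν] {g : Ω → ℝ} (hg : Integrable g ν) {c : ℝ} (hc : ∀ x, c ≤ g x) :
    c ≤ ∫ x, g x ∂ν := by
  simpa using integral_mono (integrable_const c) hg hc

/-- A lower bound for the conditional expectation over loss function and action, given any history
and context, is a lower bound for the expectation. -/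
lemma le_integral_history_round (hk : 0 ≤ 4 * theta q * γ * h) (t : ℕ)
    {G : History X A S t × (X × S × A) → ℝ} (hG : Measurable G) {C : ℝ} (hC : ∀ p, |G p| ≤ C)
    {c : ℝ} (hc : ∀ H x, c ≤ ∫ a, ∫ s, G (H, (x, (s, a))) ∂(E.lossLaw t (H, x))
      ∂(actionLaw E F O P μ q h γ t (H, x))) :
    c ≤ ∫ p, G p ∂(historyLaw E F O P μ q h γ t ⊗ₘ roundLaw E F O P μ q h γ t) := by
  have := isProbabilityMeasure_historyLaw E F O P μ hk t
  have := isMarkovKernel_roundLaw E F O P μ hk t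
  have := isMarkovKernel_actionLaw E F O P μ hk t
  have hGi : Integrable G (historyLaw E F O P μ q h γ t ⊗ₘ roundLaw E F O P μ q h γ t) :=
    integrable_of_forall_abs_le hG hC
  rw [Measure.integral_compProd hGi]
  have hGi' : Integrable (fun H => ∫ y, G (H, y) ∂(roundLaw E F O P μ q h γ t H))
      (historyLaw E F O P μ q h γ t) := by
    rw [Measure.compProd] at hGi
    simpa using hGi.integral_compProd
  refine le_integral_of_forall_le hGi' fun H => ?_
  have hGH : Measurable fun y : X × S × A => G (H, y) := hG.comp measurable_prodMk_left
  have hGHi : Integrable (fun y : X × S × A => G (H, y)) (roundLaw E F O P μ q h γ t H) :=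
    integrable_of_forall_abs_le hGH fun y => hC _
  rw [roundLaw] at hGHi ⊢
  rw [ProbabilityTheory.integral_compProd hGHi]
  refine le_integral_of_forall_le hGHi.integral_compProd fun x => ?_
  -- Loss function and action are independent given history and context, so Fubini allows the loss
  -- to be averaged first, with the action fixed.
  rw [Kernel.prod_apply, integral_prod_symm]
  · exact hc H x
  · exact integrable_of_forall_abs_le (hGH.comp measurable_prodMk_left) fun y => hC _

/-- The prediction of the regression oracle for the loss of an action. -/
def predicted (t : ℕ) (H : History X A S t) (x : X) (a : A) : ℝ :=
  F.eval (O.predict t (E.observe H) x) x a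

lemma measurable_predicted (t : ℕ) :
    Measurable fun p : (History X A S t × X) × A => predicted E F O t p.1.1 p.1.2 p.2 := by
  have h1 : Measurable fun p : (History X A S t × X) × A => O.predict t (E.observe p.1.1) p.1.2 :=
    (O.measurable_predict t).comp
      (((E.measurable_observe t).comp (measurable_fst.comp measurable_fst)).prodMk
        (measurable_snd.comp measurable_fst))
  exact F.measurable_eval.comp
    ((h1.prodMk (measurable_snd.comp measurable_fst)).prodMk measurable_snd)

lemma predicted_mem (t : ℕ) (H : History X A S t) (x : X) (a : A) :
    predicted E F O t H x a ∈ Icc (0 : ℝ) 1 := F.eval_mem _ _ _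

/-- The loss of the regression oracle in round `t` in excess of the one of `φ`. -/
def excessLoss (φ : Φ) (q : ℝ) (t : ℕ) (p : History X A S t × (X × S × A)) : ℝ :=
  expectileLoss q (E.loss p.2.2.1 p.2.2.2) (predicted E F O t p.1 p.2.1 p.2.2.2)
    - expectileLoss q (E.loss p.2.2.1 p.2.2.2) (F.eval φ p.2.1 p.2.2.2)

lemma measurable_excessLoss (φ : Φ) (q : ℝ) (t : ℕ) :
    Measurable (excessLoss E F O φ q t) := by
  have hl : Measurable fun p : History X A S t × (X × S × A) => E.loss p.2.2.1 p.2.2.2 :=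
    E.measurable_loss.comp (measurable_snd.comp measurable_snd)
  have h1 : Measurable fun p : History X A S t × (X × S × A) =>
      predicted E F O t p.1 p.2.1 p.2.2.2 :=
    (measurable_predicted E F O t).comp
      ((measurable_fst.prodMk (measurable_fst.comp measurable_snd)).prodMk
        (measurable_snd.comp (measurable_snd.comp measurable_snd)))
  have h2 : Measurable fun p : History X A S t × (X × S × A) => F.eval φ p.2.1 p.2.2.2 :=
    F.measurable_eval.comp
      ((measurable_const.prodMk (measurable_fst.comp measurable_snd)).prodMk
        (measurable_snd.comp (measurable_snd.comp measurable_snd)))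
  exact ((continuous_expectileLoss q).measurable.comp (hl.prodMk h1)).sub
    ((continuous_expectileLoss q).measurable.comp (hl.prodMk h2))

lemma abs_excessLoss_le (hq0 : 0 < q) (hq1 : q < 1) (φ : Φ) (t : ℕ)
    (p : History X A S t × (X × S × A)) : |excessLoss E F O φ q t p| ≤ 1 := by
  have h1 := expectileLoss_mem_Icc hq0 hq1 (E.loss_mem p.2.2.1 p.2.2.2)
    (predicted_mem E F O t p.1 p.2.1 p.2.2.2)
  have h2 := expectileLoss_mem_Icc hq0 hq1 (E.loss_mem p.2.2.1 p.2.2.2)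
    (F.eval_mem φ p.2.1 p.2.2.2)
  exact abs_le.2 ⟨by unfold excessLoss; linarith [h1.1, h2.2],
    by unfold excessLoss; linarith [h1.2, h2.1]⟩

/-- With the action fixed, `hφ` says that the benchmark predicts the expectile of the conditional
loss law, so `theta_mul_sq_le_excess` applies. -/
lemma theta_mul_sq_le_integral_excessLoss (hq0 : 0 < q) (hq1 : q < 1) {φ : Φ} {t : ℕ}
    {H : History X A S t} {x : X} {a : A} (hφ : F.eval φ x a = EVaR q (E.lossDist t H x a)) :
    theta q * (predicted E F O t H x a - F.eval φ x a) ^ 2 ≤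
      ∫ s, excessLoss E F O φ q t (H, (x, (s, a))) ∂(E.lossLaw t (H, x)) := by
  have := theta_mul_sq_le_excess (ν := E.lossLaw t (H, x)) hq0 hq1 (E.measurable_loss_left a)
    (fun s => E.loss_mem s a) (predicted_mem E F O t H x a)
  simp only [excessLoss]
  rw [hφ]
  exact this

/-- Disintegration over the approximate minimizer `b`, which lets estimates for a fixed `b` be
averaged over the optimization oracle. -/
lemma integral_actionLaw (hk : 0 ≤ 4 * theta q * γ * h) (t : ℕ) (H : History X A S t) (x : X)
    {g : A → ℝ} (hg : Measurable g) {C : ℝ} (hC : ∀ a, |g a| ≤ C) :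
    Integrable (fun b => ∫ a, g a ∂(contAL q h γ μ (predicted E F O t H x) b))
        (P.choose (1 / (4 * theta q * γ)) (O.predict t (E.observe H) x, x)) ∧
      ∫ a, g a ∂(actionLaw E F O P μ q h γ t (H, x)) =
        ∫ b, ∫ a, g a ∂(contAL q h γ μ (predicted E F O t H x) b)
          ∂(P.choose (1 / (4 * theta q * γ)) (O.predict t (E.observe H) x, x)) := by
  have := isMarkovKernel_contALKernel F μ hk
  set c : Φ × X := (O.predict t (E.observe H) x, x) with hc
  have hgm : Measurable fun p : (Φ × X) × A => ∫ a, g a ∂(contALKernel q h γ μ F p) :=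
    (hg.stronglyMeasurable.integral_kernel (κ := contALKernel q h γ μ F)).measurable
  have hint : Integrable g ((contALKernel q h γ μ F ∘ₖ
      (Kernel.id ×ₖ P.choose (1 / (4 * theta q * γ)))) c) := integrable_of_forall_abs_le hg hC
  have hi := hint.integral_comp
  have heq := Kernel.integral_comp hint
  rw [Kernel.prod_apply, Kernel.id_apply, Measure.dirac_prod] at hi heq
  rw [integral_map measurable_prodMk_left.aemeasurable hgm.aestronglyMeasurable] at heq
  rw [integrable_map_measure hgm.aestronglyMeasurable measurable_prodMk_left.aemeasurable] at hi
  refine ⟨hi, ?_⟩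
  rw [actionLaw, Kernel.comap_apply]
  exact heq

/-! ### Regret and excess loss of a single round -/

section Round

variable {t : ℕ} {φ : Φ}

/-- Replacing `EVaR` by the realizing function supplies joint measurability and removes the
dependence on the history from the comparator term. -/
lemma roundRegret_eq
    (hφ : ∀ (H : History X A S t) x a, F.eval φ x a = EVaR q (E.lossDist t H x a))
    (H : History X A S t) (x : X) :
    roundRegret E F O P μ q h γ t H x =
      ∫ a, F.eval φ x a ∂(actionLaw E F O P μ q h γ t (H, x))
        - ⨅ Q : smoothComparators μ h, ∫ a, F.eval φ x a ∂(Q : Measure A) := by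
  simp only [roundRegret, ← hφ H x]

lemma measurable_roundRegret (hh0 : 0 < h) (hh1 : h ≤ 1) (hk : 0 ≤ 4 * theta q * γ * h)
    (hφ : ∀ (H : History X A S t) x a, F.eval φ x a = EVaR q (E.lossDist t H x a)) :
    Measurable fun p : History X A S t × (X × S × A) =>
      roundRegret E F O P μ q h γ t p.1 p.2.1 := by
  have := isMarkovKernel_actionLaw E F O P μ hk t
  simp only [roundRegret_eq E F O P μ hφ]
  have hx : Measurable fun p : History X A S t × (X × S × A) => p.2.1 :=
    measurable_fst.comp measurable_snd
  have he : Measurable fun p : X × A => F.eval φ p.1 p.2 :=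
    F.measurable_eval.comp ((measurable_const.prodMk measurable_fst).prodMk measurable_snd)
  have h1 : Measurable fun p : History X A S t × X =>
      ∫ a, F.eval φ p.2 a ∂(actionLaw E F O P μ q h γ t p) :=
    StronglyMeasurable.measurable <| StronglyMeasurable.integral_kernel_prod_right'
      (f := fun p : (History X A S t × X) × A => F.eval φ p.1.2 p.2)
      (he.comp ((measurable_snd.comp measurable_fst).prodMk measurable_snd)).stronglyMeasurable
  exact (h1.comp (measurable_fst.prodMk hx)).sub
    ((measurable_iInf_smoothComparators hh0 hh1 he fun x a => F.eval_mem φ x a).comp hx)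

lemma abs_roundRegret_le (hh0 : 0 < h) (hh1 : h ≤ 1) (hk : 0 ≤ 4 * theta q * γ * h)
    (hφ : ∀ (H : History X A S t) x a, F.eval φ x a = EVaR q (E.lossDist t H x a))
    (H : History X A S t) (x : X) : |roundRegret E F O P μ q h γ t H x| ≤ 1 := by
  have := isMarkovKernel_actionLaw E F O P μ hk t
  rw [roundRegret_eq E F O P μ hφ]
  have h1 := integral_mem_Icc (actionLaw E F O P μ q h γ t (H, x)) (F.measurable_section φ x)
    (F.eval_mem φ x)
  have h2 := iInf_smoothComparators_mem_Icc (μ := μ) hh0 hh1 (F.measurable_section φ x)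
    (F.eval_mem φ x)
  exact abs_le.2 ⟨by linarith [h1.1, h2.2], by linarith [h1.2, h2.1]⟩

/-- Average `contAL_regret_le` over `b`: exploration costs `2/(κh)`, and the oracle error `1/κ`,
multiplied by `1/h`, adds the third `1/(κh)`. -/
lemma roundRegret_le (hP : P.IsAccurate F μ) (hκ : 0 < 4 * theta q * γ) (hh0 : 0 < h)
    (hh1 : h ≤ 1)
    (hφ : ∀ (H : History X A S t) x a, F.eval φ x a = EVaR q (E.lossDist t H x a))
    (H : History X A S t) (x : X) :
    roundRegret E F O P μ q h γ t H x ≤ 3 / (4 * theta q * γ * h)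
      + γ * theta q * ∫ a, (predicted E F O t H x a - F.eval φ x a) ^ 2
        ∂(actionLaw E F O P μ q h γ t (H, x)) := by
  have hk : 0 ≤ 4 * theta q * γ * h := by positivity
  have hpm : Measurable (predicted E F O t H x) := F.measurable_section _ _
  have hgm := F.measurable_section φ x
  have hgC : ∀ a, |F.eval φ x a| ≤ 1 := fun a =>
    abs_le.2 ⟨by linarith [(F.eval_mem φ x a).1], (F.eval_mem φ x a).2⟩
  have hsm : Measurable fun a => (predicted E F O t H x a - F.eval φ x a) ^ 2 :=
    (hpm.sub hgm).pow_const 2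
  have hsC : ∀ a, |(predicted E F O t H x a - F.eval φ x a) ^ 2| ≤ 1 := fun a => by
    rw [abs_pow]
    refine pow_le_one₀ (abs_nonneg _) (abs_le.2 ?_)
    have h1 := predicted_mem E F O t H x a
    have h2 := F.eval_mem φ x a
    exact ⟨by linarith [h1.1, h2.2], by linarith [h1.2, h2.1]⟩
  obtain ⟨i1, e1⟩ := integral_actionLaw E F O P μ hk t H x hgm hgC
  obtain ⟨i2, e2⟩ := integral_actionLaw E F O P μ hk t H x hsm hsC
  have hacc := hP (1 / (4 * theta q * γ)) (by positivity) (O.predict t (E.observe H) x) x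
  have i3 : Integrable (fun b => ∫ a, max 0 (predicted E F O t H x b - predicted E F O t H x a) ∂μ)
      (P.choose (1 / (4 * theta q * γ)) (O.predict t (E.observe H) x, x)) := by
    have hm : Measurable fun p : A × A =>
        max 0 (predicted E F O t H x p.1 - predicted E F O t H x p.2) :=
      measurable_const.max ((hpm.comp measurable_fst).sub (hpm.comp measurable_snd))
    refine integrable_of_forall_mem_Icc hm.stronglyMeasurable.integral_prod_right.measurable
      fun b => integral_mem_Icc μ (hm.comp measurable_prodMk_left) fun a => ?_
    have h1 := predicted_mem E F O t H x a
    have h2 := predicted_mem E F O t H x b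
    exact ⟨le_max_left _ _, max_le zero_le_one (by linarith [h1.1, h2.2])⟩
  have : Nonempty (smoothComparators μ h) := ⟨⟨μ, self_mem_smoothComparators hh0 hh1⟩⟩
  rw [roundRegret_eq E F O P μ hφ, sub_le_comm]
  refine le_ciInf fun Q => ?_
  have hb : ∀ b, ∫ a, F.eval φ x a ∂(contAL q h γ μ (predicted E F O t H x) b) ≤
      (2 / (4 * theta q * γ * h) + ∫ a, F.eval φ x a ∂(Q : Measure A))
        + 4 * theta q * γ / 4 * ∫ a, (predicted E F O t H x a - F.eval φ x a) ^ 2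
          ∂(contAL q h γ μ (predicted E F O t H x) b)
        + 1 / h * ∫ a, max 0 (predicted E F O t H x b - predicted E F O t H x a) ∂μ := fun b => by
    have := contAL_regret_le hκ hh0 hpm (predicted_mem E F O t H x) hgm (F.eval_mem φ x) b Q.2
    linarith
  have hint := integral_mono i1 (((integrable_const _).add (i2.const_mul _)).add
    (i3.const_mul _)) hb
  rw [integral_add' ((integrable_const _).add (i2.const_mul _)) (i3.const_mul _),
    integral_add' (integrable_const _) (i2.const_mul _), integral_const_mul, integral_const_mul,
    ← e1, ← e2] at hint
  simp only [integral_const, probReal_univ, one_smul] at hint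
  have h3 := mul_le_mul_of_nonneg_left hacc (by positivity : 0 ≤ 1 / h)
  have h4 : 1 / h * (1 / (4 * theta q * γ)) = 1 / (4 * theta q * γ * h) := by
    rw [one_div_mul_one_div, mul_comm h]
  have h5 : 3 / (4 * theta q * γ * h) = 2 / (4 * theta q * γ * h) + 1 / (4 * theta q * γ * h) := by
    ring
  rw [h5]
  simp only [predicted] at hint ⊢
  linarith

lemma integral_excessLoss_nonneg (hq0 : 0 < q) (hq1 : q < 1) (hk : 0 ≤ 4 * theta q * γ * h)
    (hφ : ∀ (H : History X A S t) x a, F.eval φ x a = EVaR q (E.lossDist t H x a)) :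
    0 ≤ ∫ p, excessLoss E F O φ q t p
      ∂(historyLaw E F O P μ q h γ t ⊗ₘ roundLaw E F O P μ q h γ t) :=
  le_integral_history_round E F O P μ hk t (measurable_excessLoss E F O φ q t)
    (abs_excessLoss_le E F O hq0 hq1 φ t) fun H x => integral_nonneg fun a =>
      (mul_nonneg (theta_pos hq0 hq1).le (sq_nonneg _)).trans
        (theta_mul_sq_le_integral_excessLoss E F O hq0 hq1 (hφ H x a))

lemma integral_roundRegret_le (hP : P.IsAccurate F μ) (hq0 : 0 < q) (hq1 : q < 1) (hγ : 0 < γ)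
    (hh0 : 0 < h) (hh1 : h ≤ 1)
    (hφ : ∀ (H : History X A S t) x a, F.eval φ x a = EVaR q (E.lossDist t H x a)) :
    ∫ p, roundRegret E F O P μ q h γ t p.1 p.2.1
        ∂(historyLaw E F O P μ q h γ t ⊗ₘ roundLaw E F O P μ q h γ t) ≤
      3 / (4 * theta q * γ * h) + γ * ∫ p, excessLoss E F O φ q t p
        ∂(historyLaw E F O P μ q h γ t ⊗ₘ roundLaw E F O P μ q h γ t) := by
  have hθ := theta_pos hq0 hq1
  have hκ : 0 < 4 * theta q * γ := by positivity
  have hk : 0 ≤ 4 * theta q * γ * h := by positivity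
  have := isProbabilityMeasure_historyLaw E F O P μ hk t
  have := isMarkovKernel_roundLaw E F O P μ hk t
  have := isMarkovKernel_actionLaw E F O P μ hk t
  have hrm := measurable_roundRegret E F O P μ hh0 hh1 hk hφ
  have hrC := abs_roundRegret_le E F O P μ hh0 hh1 hk hφ
  have hem := measurable_excessLoss E F O φ q t
  have heC := abs_excessLoss_le E F O hq0 hq1 φ t
  -- Regret and excess loss are bounded jointly, since only their combination has a deterministic
  -- conditional bound.
  have key := le_integral_history_round E F O P μ (γ := γ) hk t
    (G := fun p => γ * excessLoss E F O φ q t p - roundRegret E F O P μ q h γ t p.1 p.2.1)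
    ((hem.const_mul γ).sub hrm) (C := γ + 1)
    (fun p => by
      refine (abs_sub _ _).trans (add_le_add ?_ (hrC _ _))
      rw [abs_mul, abs_of_pos hγ]
      exact mul_le_of_le_one_right hγ.le (heC p))
    (c := -(3 / (4 * theta q * γ * h))) fun H x => by
      set ν := actionLaw E F O P μ q h γ t (H, x)
      have hemx : Measurable fun p : S × A => excessLoss E F O φ q t (H, (x, p)) :=
        hem.comp (measurable_prodMk_left.comp measurable_prodMk_left)
      have hin : ∀ a, ∫ s, (γ * excessLoss E F O φ q t (H, (x, (s, a)))
          - roundRegret E F O P μ q h γ t H x) ∂(E.lossLaw t (H, x)) =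
          γ * ∫ s, excessLoss E F O φ q t (H, (x, (s, a))) ∂(E.lossLaw t (H, x))
            - roundRegret E F O P μ q h γ t H x := fun a => by
        have hia : Integrable (fun s => excessLoss E F O φ q t (H, (x, (s, a))))
            (E.lossLaw t (H, x)) :=
          integrable_of_forall_abs_le (hemx.comp measurable_prodMk_right) fun s => heC _
        rw [integral_sub (hia.const_mul γ) (integrable_const _),
          integral_const_mul]
        simp
      simp only [hin]
      have hI : Integrable (fun a =>
          ∫ s, excessLoss E F O φ q t (H, (x, (s, a))) ∂(E.lossLaw t (H, x))) ν := by
        refine integrable_of_forall_abs_le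
          (hemx.stronglyMeasurable.integral_prod_left').measurable (C := 1) fun a => ?_
        have := norm_integral_le_of_norm_le_const (μ := E.lossLaw t (H, x)) (C := 1)
          (f := fun s => excessLoss E F O φ q t (H, (x, (s, a)))) (ae_of_all _ fun s => heC _)
        simpa using this
      rw [integral_sub (hI.const_mul γ) (integrable_const _), integral_const_mul]
      simp only [integral_const, probReal_univ, one_smul]
      have hpm : Measurable (predicted E F O t H x) := F.measurable_section _ _
      have hsm : Measurable fun a => (predicted E F O t H x a - F.eval φ x a) ^ 2 :=
        (hpm.sub (F.measurable_section φ x)).pow_const 2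
      have hsi : Integrable (fun a => theta q * (predicted E F O t H x a - F.eval φ x a) ^ 2) ν :=
        hI.mono' (hsm.const_mul _).aestronglyMeasurable (ae_of_all _ fun a => by
          rw [Real.norm_eq_abs, abs_of_nonneg (by positivity)]
          exact theta_mul_sq_le_integral_excessLoss E F O hq0 hq1 (hφ H x a))
      have h1 := integral_mono hsi hI fun a =>
        theta_mul_sq_le_integral_excessLoss E F O hq0 hq1 (hφ H x a)
      rw [integral_const_mul] at h1
      have h2 := mul_le_mul_of_nonneg_left h1 hγ.le
      have h3 := roundRegret_le E F O P μ hP hκ hh0 hh1 hφ H x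
      linarith
  rw [integral_sub ((integrable_of_forall_abs_le hem heC).const_mul γ)
    (integrable_of_forall_abs_le hrm fun p => hrC _ _), integral_const_mul] at key
  linarith

end Round

/-! ### Summation over the rounds -/

section Total

variable {𝓕 : Set Φ} {T : ℕ} {R : ℝ}

lemma sum_integral_excessLoss_le (hq0 : 0 < q) (hq1 : q < 1) (hk : 0 ≤ 4 * theta q * γ * h)
    (hO : O.HasRegretBound F 𝓕 q T R) {φ : Φ} (hφ : φ ∈ 𝓕) :
    ∑ t : Fin T, ∫ p, excessLoss E F O φ q t p
      ∂(historyLaw E F O P μ q h γ t ⊗ₘ roundLaw E F O P μ q h γ t) ≤ R := by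
  have := isProbabilityMeasure_historyLaw E F O P μ hk T
  have hmap : ∀ t : Fin T, ∫ p, excessLoss E F O φ q t p
      ∂(historyLaw E F O P μ q h γ t ⊗ₘ roundLaw E F O P μ q h γ t) =
      ∫ H, excessLoss E F O φ q t (H.round t) ∂(historyLaw E F O P μ q h γ T) := fun t => by
    rw [← map_round_historyLaw E F O P μ hk t, integral_map (measurable_round t).aemeasurable
      (measurable_excessLoss E F O φ q t).aestronglyMeasurable]
  have hi : ∀ t : Fin T, Integrable (fun H => excessLoss E F O φ q t (H.round t))
      (historyLaw E F O P μ q h γ T) := fun t =>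
    integrable_of_forall_abs_le ((measurable_excessLoss E F O φ q t).comp (measurable_round t))
      fun H => abs_excessLoss_le E F O hq0 hq1 φ t _
  simp only [hmap]
  rw [← integral_finsetSum _ fun t _ => hi t]
  -- The oracle guarantee holds on every sequence, hence pathwise; observing a prefix of the history
  -- gives the prefix of the observations.
  have hle : ∀ H : History X A S T, ∑ t : Fin T, excessLoss E F O φ q t (H.round t) ≤ R :=
    fun H => hO (E.observe H) (fun t => E.loss_mem _ _) φ hφ
  simpa using integral_mono (integrable_finsetSum _ fun t _ => hi t)
    (integrable_const (μ := historyLaw E F O P μ q h γ T) R) hle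

/-- The realizing function minimizes the conditional expected loss, so no oracle has negative
expected regret against it. This makes the radicand of the first choice of `γ` positive. -/
lemma regretBound_nonneg (P : OptimizationOracle Φ X A) (μ : Measure A)
    [IsProbabilityMeasure μ] (hq0 : 0 < q) (hq1 : q < 1)
    (hreal : E.Realizable F 𝓕 q T) (hO : O.HasRegretBound F 𝓕 q T R) : 0 ≤ R := by
  obtain ⟨φ, hφ, hφE⟩ := hreal
  -- Any interaction serves here; `γ = 0` and `h = 1` make the algorithm sample from `μ` itself.
  have hk : 0 ≤ 4 * theta q * 0 * 1 := by simp
  exact (Finset.sum_nonneg fun (t : Fin T) _ => integral_excessLoss_nonneg E F O P μ hq0 hq1 hk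
    (hφE t t.isLt)).trans (sum_integral_excessLoss_le E F O P μ hq0 hq1 hk hO hφ)

lemma expectedRegretLE (hP : P.IsAccurate F μ) (hq0 : 0 < q) (hq1 : q < 1) (hγ : 0 < γ)
    (hh0 : 0 < h) (hh1 : h ≤ 1) (hreal : E.Realizable F 𝓕 q T)
    (hO : O.HasRegretBound F 𝓕 q T R) :
    ExpectedRegretLE E F O P μ q h γ T (T * (3 / (4 * theta q * γ * h)) + γ * R) := by
  obtain ⟨φ, hφ, hφE⟩ := hreal
  have hk : 0 ≤ 4 * theta q * γ * h := by have := theta_pos hq0 hq1; positivity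
  have := isProbabilityMeasure_historyLaw E F O P μ hk T
  have hrm : ∀ t : Fin T, Measurable fun p : History X A S t × (X × S × A) =>
      roundRegret E F O P μ q h γ t p.1 p.2.1 := fun t =>
    measurable_roundRegret E F O P μ hh0 hh1 hk (hφE t t.isLt)
  have hi : ∀ t : Fin T, Integrable (fun H : History X A S T =>
      roundRegret E F O P μ q h γ t (H.round t).1 (H.round t).2.1)
      (historyLaw E F O P μ q h γ T) := fun t =>
    integrable_of_forall_abs_le ((hrm t).comp (measurable_round t))
      fun H => abs_roundRegret_le E F O P μ hh0 hh1 hk (hφE t t.isLt) _ _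
  refine ⟨integrable_finsetSum _ fun t _ => hi t, ?_⟩
  have hsum : ∫ H, regret E F O P μ q h γ T H ∂(historyLaw E F O P μ q h γ T) =
      ∑ t : Fin T, ∫ p, roundRegret E F O P μ q h γ t p.1 p.2.1
        ∂(historyLaw E F O P μ q h γ t ⊗ₘ roundLaw E F O P μ q h γ t) := by
    refine (integral_finsetSum _ fun t _ => hi t).trans (Finset.sum_congr rfl fun t _ => ?_)
    rw [← map_round_historyLaw E F O P μ hk t, integral_map (measurable_round t).aemeasurable
      (hrm t).aestronglyMeasurable]
  rw [hsum]
  refine (Finset.sum_le_sum fun (t : Fin T) _ =>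
    integral_roundRegret_le E F O P μ hP hq0 hq1 hγ hh0 hh1 (hφE t t.isLt)).trans ?_
  rw [Finset.sum_add_distrib, ← Finset.mul_sum]
  have := mul_le_mul_of_nonneg_left (sum_integral_excessLoss_le E F O P μ hq0 hq1 hk hO hφ) hγ.le
  simpa using this

end Total

end Interaction

end RiskCB

/-! ### Choice of the parameter `γ` -/

lemma RiskCB.regret_bound_tuned_additive {θ h T R : ℝ} (hθ : 0 < θ) (hh : 0 < h) (hT : 0 < T)
    (hR : 0 ≤ R) :
    T * (3 / (4 * θ * √(3 * T / (h * (16 + 12 * θ * (1 + R)))) * h))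
        + √(3 * T / (h * (16 + 12 * θ * (1 + R)))) * R ≤
      1 / θ * √(1 / h * (3 * T) * (4 + 3 * θ * (1 + R))) := by
  obtain ⟨K, hK⟩ : ∃ K, K = 4 + 3 * θ * (1 + R) := ⟨_, rfl⟩
  have hK0 : 0 < K := by rw [hK]; positivity
  have e1 : 16 + 12 * θ * (1 + R) = 4 * K := by rw [hK]; ring
  rw [e1, ← hK]
  set g := √(3 * T / (h * (4 * K))) with hg
  have hg0 : 0 < g := Real.sqrt_pos.2 (by positivity)
  have hg2 : g ^ 2 = 3 * T / (h * (4 * K)) := Real.sq_sqrt (by positivity)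
  have e2 : √(1 / h * (3 * T) * K) = 2 * K * g := by
    rw [Real.sqrt_eq_iff_eq_sq (by positivity) (by positivity), mul_pow, hg2]
    field_simp; ring
  have e3 : T * (3 / (4 * θ * g * h)) = K * g / θ := by
    have : 3 * T = g ^ 2 * (h * (4 * K)) := by rw [hg2]; field_simp
    have h3 : T * (3 / (4 * θ * g * h)) = 3 * T / (4 * θ * g * h) := by ring
    rw [h3, this]; field_simp
  -- The first summand equals `K g / θ`, and `θ R ≤ K` bounds the second by the same amount.
  have h4 : R ≤ K / θ := by
    rw [le_div_iff₀ hθ, hK]; nlinarith [mul_nonneg hθ.le hR]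
  rw [e2, e3]
  have h5 := mul_le_mul_of_nonneg_left h4 hg0.le
  have e6 : 1 / θ * (2 * K * g) = K * g / θ + g * (K / θ) := by ring
  linarith

/-- This `γ` balances the two summands, both equal to `γ R`. Their sum is `√(3TR/(θh))`, and `θ ≤ 1`
weakens `1/√θ` to `1/θ`. -/
lemma RiskCB.regret_bound_tuned {θ h T R : ℝ} (hθ : 0 < θ) (hθ1 : θ ≤ 1) (hh : 0 < h)
    (hT : 0 < T) (hR : 0 < R) :
    T * (3 / (4 * θ * √(3 * T / (4 * θ * h * R)) * h)) + √(3 * T / (4 * θ * h * R)) * R ≤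
      √3 * (1 / θ * √(1 / h * T * R)) := by
  set g := √(3 * T / (4 * θ * h * R)) with hg
  have hg0 : 0 < g := Real.sqrt_pos.2 (by positivity)
  have hg2 : g ^ 2 = 3 * T / (4 * θ * h * R) := Real.sq_sqrt (by positivity)
  have e1 : T * (3 / (4 * θ * g * h)) = g * R := by
    have : 3 * T = g ^ 2 * (4 * θ * h * R) := by rw [hg2]; field_simp
    have h3 : T * (3 / (4 * θ * g * h)) = 3 * T / (4 * θ * g * h) := by ring
    rw [h3, this]; field_simp
  have e2 : √3 * (1 / θ * √(1 / h * T * R)) = √(3 * (1 / h * T * R)) / θ := by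
    rw [Real.sqrt_mul (by norm_num : (0 : ℝ) ≤ 3) (1 / h * T * R)]; ring
  rw [e1, e2, le_div_iff₀ hθ]
  refine Real.le_sqrt_of_sq_le ?_
  have e3 : ((g * R + g * R) * θ) ^ 2 = g ^ 2 * (4 * R ^ 2 * θ ^ 2) := by ring
  have e4 : 3 * T / (4 * θ * h * R) * (4 * R ^ 2 * θ ^ 2) = 3 * (1 / h * T * R) * θ := by
    field_simp
  rw [e3, hg2, e4]
  exact mul_le_of_le_one_right (by positivity) hθ1

theorem theorem2 {X A S Φ : Type*} [MeasurableSpace X] [MeasurableSpace A] [MeasurableSpace S]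
    [MeasurableSpace Φ]
    (E : RiskCB.Environment X A S) (F : RiskCB.FunctionClass Φ X A) (𝓕 : Set Φ)
    (O : RiskCB.RegressionOracle Φ X A) (P : RiskCB.OptimizationOracle Φ X A)
    (μ : Measure A) [IsProbabilityMeasure μ]
    (q : ℝ) (hq0 : 0 < q) (hq1 : q < 1)
    (h : ℝ) (hh0 : 0 < h) (hh1 : h ≤ 1)
    (T : ℕ) (hT : 1 ≤ T) (R : ℝ)
    (hreal : E.Realizable F 𝓕 q T)
    (hO : O.HasRegretBound F 𝓕 q T R)
    (hP : P.IsAccurate F μ) :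
    RiskCB.ExpectedRegretLE E F O P μ q h
        (Real.sqrt (3 * T / (h * (16 + 12 * RiskCB.theta q * (1 + R))))) T
        (1 / RiskCB.theta q *
          Real.sqrt (1 / h * (3 * T) * (4 + 3 * RiskCB.theta q * (1 + R)))) ∧
    (0 < R →
      RiskCB.ExpectedRegretLE E F O P μ q h
        (Real.sqrt (3 * T / (4 * RiskCB.theta q * h * R))) T
        (Real.sqrt 3 * (1 / RiskCB.theta q * Real.sqrt (1 / h * T * R)))) := by
  have hθ := RiskCB.theta_pos hq0 hq1
  have hθ1 : RiskCB.theta q ≤ 1 := (min_le_left _ _).trans hq1.le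
  have hT0 : (0 : ℝ) < T := by exact_mod_cast hT
  have hR := RiskCB.regretBound_nonneg E F O P μ hq0 hq1 hreal hO
  refine ⟨?_, fun hR0 => ?_⟩
  · obtain ⟨hi, hle⟩ := RiskCB.expectedRegretLE E F O P μ hP hq0 hq1
      (Real.sqrt_pos.2 (by positivity :
        0 < 3 * (T : ℝ) / (h * (16 + 12 * RiskCB.theta q * (1 + R))))) hh0 hh1 hreal hO
    exact ⟨hi, hle.trans (RiskCB.regret_bound_tuned_additive hθ hh0 hT0 hR)⟩
  · obtain ⟨hi, hle⟩ := RiskCB.expectedRegretLE E F O P μ hP hq0 hq1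
      (Real.sqrt_pos.2 (by positivity :
        0 < 3 * (T : ℝ) / (4 * RiskCB.theta q * h * R))) hh0 hh1 hreal hO
    exact ⟨hi, hle.trans (RiskCB.regret_bound_tuned hθ hθ1 hh0 hT0 hR0)⟩
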